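/- Let $n\ge 2$ and let $(M,\langle\cdot,\cdot\rangle,I,\Psi)$ be a special almost Hermitian $2n$-manifold: a smooth Riemannian $2n$-manifold with an orthogonal almost complex structure $I$ and a smooth complex volume form $\Psi=\psi_++i\psi_-$, i.e. a complex-valued $n$-form with $\Psi(IX_1,X_2,\dots,X_n)=i\,\Psi(X_1,\dots,X_n)$ and $\frac1{n!}\sum_{i_1,\dots,i_n=1}^n|\Psi(u_{i_1},\dots,u_{i_n})|^2=1$ for unitary bases $u_1,\dots,u_n$. Let $\nabla$ be the Levi-Civita connection, put $\xi_XY=-\frac12I(\nabla_XI)Y$, and let $\widetilde\nabla=\nabla+\xi$ be the minimal $\mathrm U(n)$-connection. Let $\overline\nabla$ be the minimal $\mathrm{SU}(n)$-connection, i.e. the connection for which $\langle\cdot,\cdot\rangle$, $I$ and $\Psi$ are parallel and $\overline\nabla-\nabla$ takes its values in the orthogonal complement of $\mathfrak{su}(n)$ in $\mathfrak{so}(2n)$. Then $\overline\nabla=\nabla+\eta+\xi$ with $\eta_XY=\hat\eta(X)\,IY$ for a one-form $\hat\eta$. Let $R_{X,Y}=\nabla_{[X,Y]}-[\nabla_X,\nabla_Y]$,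 and, for an orthonormal basis $e_1,\dots,e_{2n}$ of the tangent space and with summation over repeated indices, $\mathrm{Ric}(X,Y)=\langle R_{X,e_i}Y,e_i\rangle$ and $\mathrm{Ric}^*(X,Y)=\langle R_{X,e_i}IY,Ie_i\rangle$; let $d\hat\eta(X,Y)=X(\hat\eta(Y))-Y(\hat\eta(X))-\hat\eta([X,Y])$. Then for all tangent vectors $X,Y$ at a point, $$\mathrm{Ric}^*(X,Y)=n\,d\hat\eta(X,IY)-\langle\xi_Xe_i,\xi_{IY}Ie_i\rangle,$$ $$\begin{aligned}\mathrm{Ric}(X,Y)={}&n\,d\hat\eta(X,IY)-\langle\xi_Xe_i,\xi_{IY}Ie_i\rangle-2\langle(\widetilde\nabla_{e_i}\xi)_XY,e_i\rangle+2\langle(\widetilde\nabla_X\xi)_{e_i}Y,e_i\rangle\\&-2\langle\xi_{\xi_{e_i}X}Y,e_i\rangle+2\langle\xi_{\xi_Xe_i}Y,e_i\rangle.\end{aligned}$$ -/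

import Mathlib

open Bundle FiberBundle VectorField
open scoped Manifold ContDiff

noncomputable section

namespace SpecialAlmostHermitian

variable {E : Type*} [NormedAddCommGroup E] [NormedSpace ℝ E] [FiniteDimensional ℝ E]
  {M : Type*} [TopologicalSpace M] [ChartedSpace E M] [IsManifold 𝓘(ℝ, E) ∞ M]
  [RiemannianBundle (fun x : M ↦ TangentSpace 𝓘(ℝ, E) x)]
  [IsContMDiffRiemannianBundle 𝓘(ℝ, E) ∞ E (fun x : M ↦ TangentSpace 𝓘(ℝ, E) x)]

local notation "⟪" v ", " w "⟫" => inner ℝ v w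


instance (x : M) : FiniteDimensional ℝ (TangentSpace 𝓘(ℝ, E) x) :=
  inferInstanceAs (FiniteDimensional ℝ E)

instance (x : M) : CompleteSpace (TangentSpace 𝓘(ℝ, E) x) :=
  FiniteDimensional.complete ℝ _

theorem mdifferentiableAt_inner {X Y : Π x : M, TangentSpace 𝓘(ℝ, E) x} {x : M}
    (hX : MDiffAt (T% X) x) (hY : MDiffAt (T% Y) x) : MDiffAt (fun y ↦ ⟪X y, Y y⟫) x :=
  @MDifferentiableAt.inner_bundle E _ _ E _ 𝓘(ℝ, E) M _ _ E _ _
    (fun x : M ↦ TangentSpace 𝓘(ℝ, E) x) _ inferInstance inferInstance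
    _ _ E _ _ E _ 𝓘(ℝ, E) M _ _ _ _ _ _ _ hX hY

/-- The right-hand side of the Koszul formula: `2⟨∇_X Y, W⟩` at `x`. -/
def koszul (Y X W : Π x : M, TangentSpace 𝓘(ℝ, E) x) (x : M) : ℝ :=
  d% (fun y ↦ ⟪Y y, W y⟫) x (X x) + d% (fun y ↦ ⟪X y, W y⟫) x (Y x)
    - d% (fun y ↦ ⟪X y, Y y⟫) x (W x)
    + ⟪mlieBracket 𝓘(ℝ, E) X Y x, W x⟫ - ⟪mlieBracket 𝓘(ℝ, E) X W x, Y x⟫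
    - ⟪mlieBracket 𝓘(ℝ, E) Y W x, X x⟫

theorem koszul_tensorial_left {Y W : Π x : M, TangentSpace 𝓘(ℝ, E) x} {x : M}
    (hY : MDiffAt (T% Y) x) (hW : MDiffAt (T% W) x) :
    TensorialAt 𝓘(ℝ, E) E (fun X ↦ koszul Y X W x) x where
  smul {f X} hf hX := by
    simp only [koszul, mlieBracket_smul_left hf hX, Pi.smul_apply', real_inner_smul_left,
      real_inner_smul_right, mvfderiv_fun_mul hf (mdifferentiableAt_inner hX hW),
      mvfderiv_fun_mul hf (mdifferentiableAt_inner hX hY), inner_add_left]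
    simp
    ring
  add hX hX' := by
    simp only [koszul, mlieBracket_add_left hX hX', Pi.add_apply, inner_add_left,
      inner_add_right, map_add,
      mvfderiv_fun_add (mdifferentiableAt_inner hX hW) (mdifferentiableAt_inner hX' hW),
      mvfderiv_fun_add (mdifferentiableAt_inner hX hY) (mdifferentiableAt_inner hX' hY)]
    simp
    ring

theorem koszul_tensorial_right {Y X : Π x : M, TangentSpace 𝓘(ℝ, E) x} {x : M}
    (hY : MDiffAt (T% Y) x) (hX : MDiffAt (T% X) x) :
    TensorialAt 𝓘(ℝ, E) E (fun W ↦ koszul Y X W x) x where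
  smul {f W} hf hW := by
    simp only [koszul, mlieBracket_smul_right hf hW, Pi.smul_apply', real_inner_smul_left,
      real_inner_smul_right, mvfderiv_fun_mul hf (mdifferentiableAt_inner hY hW),
      mvfderiv_fun_mul hf (mdifferentiableAt_inner hX hW), inner_add_left]
    simp [real_inner_comm]
    ring
  add hW hW' := by
    simp only [koszul, mlieBracket_add_right hW hW', Pi.add_apply, inner_add_left,
      inner_add_right, map_add,
      mvfderiv_fun_add (mdifferentiableAt_inner hX hW) (mdifferentiableAt_inner hX hW'),
      mvfderiv_fun_add (mdifferentiableAt_inner hY hW) (mdifferentiableAt_inner hY hW')]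
    simp
    ring


/-- The Koszul expression, as a bilinear form in the values of `X` and `W` at `x`. -/
def koszulHom {Y : Π x : M, TangentSpace 𝓘(ℝ, E) x} {x : M} (hY : MDiffAt (T% Y) x) :
    TangentSpace 𝓘(ℝ, E) x →L[ℝ] TangentSpace 𝓘(ℝ, E) x →L[ℝ] ℝ :=
  TensorialAt.mkHom₂ (fun X W ↦ koszul Y X W x) x
    (fun _ hW ↦ koszul_tensorial_left hY hW) (fun _ hX ↦ koszul_tensorial_right hY hX)

theorem koszulHom_apply {Y X W : Π x : M, TangentSpace 𝓘(ℝ, E) x} {x : M}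
    (hY : MDiffAt (T% Y) x) (hX : MDiffAt (T% X) x) (hW : MDiffAt (T% W) x) :
    koszulHom hY (X x) (W x) = koszul Y X W x :=
  TensorialAt.mkHom₂_apply _ _ hX hW

open Classical in
/-- `leviCivitaAux Y x v = ∇_v Y`, the vector dual to half the Koszul expression. (At points where
`Y` is not differentiable, the value is irrelevant and set to `0`.) -/
def leviCivitaAux (Y : Π x : M, TangentSpace 𝓘(ℝ, E) x) (x : M) :
    TangentSpace 𝓘(ℝ, E) x →L[ℝ] TangentSpace 𝓘(ℝ, E) x :=
  if hY : MDiffAt (T% Y) x then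
    LinearMap.toContinuousLinearMap
      { toFun := fun v ↦
          (InnerProductSpace.toDual ℝ (TangentSpace 𝓘(ℝ, E) x)).symm ((2⁻¹ : ℝ) • koszulHom hY v)
        map_add' := fun v w ↦ by simp
        map_smul' := fun c v ↦ by simp [smul_comm c] }
  else 0

theorem inner_leviCivitaAux {Y X W : Π x : M, TangentSpace 𝓘(ℝ, E) x} {x : M}
    (hY : MDiffAt (T% Y) x) (hX : MDiffAt (T% X) x) (hW : MDiffAt (T% W) x) :
    ⟪leviCivitaAux Y x (X x), W x⟫ = 2⁻¹ * koszul Y X W x := by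
  rw [← koszulHom_apply hY hX hW, leviCivitaAux, dif_pos hY]
  simp [real_inner_smul_left]

theorem leviCivitaAux_ext {x : M}
    {A B : TangentSpace 𝓘(ℝ, E) x →L[ℝ] TangentSpace 𝓘(ℝ, E) x}
    (h : ∀ X W : Π x : M, TangentSpace 𝓘(ℝ, E) x, MDiffAt (T% X) x → MDiffAt (T% W) x →
      ⟪A (X x), W x⟫ = ⟪B (X x), W x⟫) : A = B := by
  ext v
  refine ext_inner_right ℝ fun w ↦ ?_
  simpa using h (extend E v) (extend E w) (mdifferentiableAt_extend ..)
    (mdifferentiableAt_extend ..)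

variable (E M) in
/-- The Levi-Civita connection `∇` of the Riemannian metric. Mathlib's argument order is
`leviCivita E M Y x v = (∇_v Y)(x)`. -/
def leviCivita : CovariantDerivative 𝓘(ℝ, E) E (fun x : M ↦ TangentSpace 𝓘(ℝ, E) x) where
  toFun := leviCivitaAux
  isCovariantDerivativeOnUniv :=
    { add := by
        intro Y Y' x hY hY' _
        refine leviCivitaAux_ext fun X W hX hW ↦ ?_
        rw [add_apply, inner_add_left, inner_leviCivitaAux hY hX hW,
          inner_leviCivitaAux hY' hX hW,
          inner_leviCivitaAux (mdifferentiableAt_add_section hY hY') hX hW]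
        simp only [koszul, mlieBracket_add_left hY hY', mlieBracket_add_right hY hY',
          Pi.add_apply, inner_add_left, inner_add_right, map_add,
          mvfderiv_fun_add (mdifferentiableAt_inner hY hW) (mdifferentiableAt_inner hY' hW),
          mvfderiv_fun_add (mdifferentiableAt_inner hX hY) (mdifferentiableAt_inner hX hY')]
        simp
        ring
      leibniz := by
        intro Y f x hY hf _
        refine leviCivitaAux_ext fun X W hX hW ↦ ?_
        have hs := inner_leviCivitaAux (hf.smul_section hY) hX hW
        have h0 := inner_leviCivitaAux hY hX hW
        refine hs.trans ?_
        simp only [add_apply, inner_add_left, smul_apply,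
          real_inner_smul_left, ContinuousLinearMap.smulRight_apply, h0]
        simp only [koszul, mlieBracket_smul_left hf hY, mlieBracket_smul_right hf hY,
          Pi.smul_apply', real_inner_smul_left,
          real_inner_smul_right, mvfderiv_fun_mul hf (mdifferentiableAt_inner hY hW),
          mvfderiv_fun_mul hf (mdifferentiableAt_inner hX hY), inner_add_left]
        simp [real_inner_comm]
        ring }

/-- The Levi-Civita connection is torsion-free. -/
theorem leviCivita_torsion {X Y : Π x : M, TangentSpace 𝓘(ℝ, E) x} {x : M}
    (hX : MDiffAt (T% X) x) (hY : MDiffAt (T% Y) x) :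
    leviCivita E M Y x (X x) - leviCivita E M X x (Y x) = mlieBracket 𝓘(ℝ, E) X Y x := by
  refine ext_inner_right ℝ fun w ↦ ?_
  have hW : MDiffAt (T% (extend E w)) x := mdifferentiableAt_extend ..
  have h1 := inner_leviCivitaAux hY hX hW
  have h2 := inner_leviCivitaAux hX hY hW
  rw [extend_apply_self] at h1 h2
  rw [inner_sub_left]
  refine (congrArg₂ _ h1 h2).trans ?_
  have e : mlieBracket 𝓘(ℝ, E) Y X x = - mlieBracket 𝓘(ℝ, E) X Y x :=
    mlieBracket_swap_apply
  have e2 : (fun y ↦ ⟪Y y, X y⟫) = fun y ↦ ⟪X y, Y y⟫ := by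
    ext y; rw [real_inner_comm]
  simp [koszul, e, e2]
  ring

/-- The Levi-Civita connection is metric. -/
theorem leviCivita_metric {X Y : Π x : M, TangentSpace 𝓘(ℝ, E) x} {x : M}
    (hX : MDiffAt (T% X) x) (hY : MDiffAt (T% Y) x) (v : TangentSpace 𝓘(ℝ, E) x) :
    d% (fun y ↦ ⟪X y, Y y⟫) x v =
      ⟪leviCivita E M X x v, Y x⟫ + ⟪X x, leviCivita E M Y x v⟫ := by
  have hV : MDiffAt (T% (extend E v)) x := mdifferentiableAt_extend ..
  have h1 := inner_leviCivitaAux hX hV hY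
  have h2 := inner_leviCivitaAux hY hV hX
  rw [extend_apply_self] at h1 h2
  rw [real_inner_comm _ (X x)]
  refine Eq.trans ?_ (congrArg₂ _ h1 h2).symm
  have e : mlieBracket 𝓘(ℝ, E) Y X x = - mlieBracket 𝓘(ℝ, E) X Y x :=
    mlieBracket_swap_apply
  have e2 (A B : Π x : M, TangentSpace 𝓘(ℝ, E) x) :
      (fun y ↦ ⟪A y, B y⟫) = fun y ↦ ⟪B y, A y⟫ := by
    ext y; rw [real_inner_comm]
  simp [koszul, e, e2 Y X]
  ring

/-! ### Curvature

Tensors are evaluated at a point `x` on tangent vectors at `x`, by extending the tangent vectors to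
vector fields that are smooth near `x`; the result does not depend on the extension. -/

/-- The curvature `R_{X,Y} Z = ∇_{[X,Y]} Z - ∇_X ∇_Y Z + ∇_Y ∇_X Z` on vector fields. -/
def curvatureField (X Y Z : Π x : M, TangentSpace 𝓘(ℝ, E) x) (x : M) : TangentSpace 𝓘(ℝ, E) x :=
  leviCivita E M Z x (mlieBracket 𝓘(ℝ, E) X Y x)
    - leviCivita E M (fun y ↦ leviCivita E M Z y (Y y)) x (X x)
    + leviCivita E M (fun y ↦ leviCivita E M Z y (X y)) x (Y x)

/-- The curvature tensor `R_{X,Y} Z` on tangent vectors at `x`. -/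
def curvature (x : M) (X Y Z : TangentSpace 𝓘(ℝ, E) x) : TangentSpace 𝓘(ℝ, E) x :=
  curvatureField (extend E X) (extend E Y) (extend E Z) x

/-- The Ricci curvature `Ric(X,Y) = ∑ i, ⟨R_{X,e_i} Y, e_i⟩`, for an orthonormal basis `e`. -/
def ricci {ι : Type*} [Fintype ι] {x : M} (e : OrthonormalBasis ι ℝ (TangentSpace 𝓘(ℝ, E) x))
    (X Y : TangentSpace 𝓘(ℝ, E) x) : ℝ :=
  ∑ i, ⟪curvature x X (e i) Y, e i⟫

/-- The exterior derivative of a one-form,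
`dθ(X,Y) = X(θ(Y)) - Y(θ(X)) - θ([X,Y])`, on tangent vectors at `x`. -/
def extDerivOneForm (θ : Π x : M, TangentSpace 𝓘(ℝ, E) x → ℝ) (x : M)
    (X Y : TangentSpace 𝓘(ℝ, E) x) : ℝ :=
  d% (fun y ↦ θ y (extend E Y y)) x X - d% (fun y ↦ θ y (extend E X y)) x Y
    - θ x (mlieBracket 𝓘(ℝ, E) (extend E X) (extend E Y) x)

/-! ### Almost Hermitian structures -/

variable (E M) in
/-- An orthogonal almost complex structure `J` (a smooth field of endomorphisms) on the Riemannian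
manifold `M`, which together with the metric makes `M` an almost Hermitian manifold. -/
structure AlmostHermitian where
  /-- the almost complex structure -/
  J : Π x : M, TangentSpace 𝓘(ℝ, E) x →L[ℝ] TangentSpace 𝓘(ℝ, E) x
  smooth_J : ContMDiff 𝓘(ℝ, E) (𝓘(ℝ, E).prod 𝓘(ℝ, E →L[ℝ] E)) ∞
    (fun x ↦ TotalSpace.mk' (E →L[ℝ] E)
      (E := fun x : M ↦ TangentSpace 𝓘(ℝ, E) x →L[ℝ] TangentSpace 𝓘(ℝ, E) x) x (J x))
  J_J : ∀ (x : M) (v : TangentSpace 𝓘(ℝ, E) x), J x (J x v) = -v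
  inner_J_J : ∀ (x : M) (v w : TangentSpace 𝓘(ℝ, E) x), ⟪J x v, J x w⟫ = ⟪v, w⟫

namespace AlmostHermitian

variable (S : AlmostHermitian E M)

theorem mdifferentiableAt_J {Y : Π x : M, TangentSpace 𝓘(ℝ, E) x} {x : M}
    (hY : MDiffAt (T% Y) x) : MDiffAt (T% (fun y ↦ S.J y (Y y))) x :=
  (S.smooth_J.mdifferentiable (by simp) x).clm_bundle_apply hY

/-- `Y ↦ (X ↦ -½ J ((∇_X J) Y))` on vector fields `Y`, at the point `x`. -/
def torsionAux (Y : Π x : M, TangentSpace 𝓘(ℝ, E) x) (x : M) :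
    TangentSpace 𝓘(ℝ, E) x →L[ℝ] TangentSpace 𝓘(ℝ, E) x :=
  (-(1 / 2) : ℝ) • (S.J x ∘L
    (leviCivita E M (fun y ↦ S.J y (Y y)) x - S.J x ∘L leviCivita E M Y x))

theorem torsionAux_tensorial (x : M) :
    TensorialAt 𝓘(ℝ, E) E (fun Y ↦ S.torsionAux Y x) x where
  smul {f Y} hf hY := by
    have h1 := (leviCivita E M).isCovariantDerivativeOnUniv.leibniz (S.mdifferentiableAt_J hY) hf
    have h2 := (leviCivita E M).isCovariantDerivativeOnUniv.leibniz hY hf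
    have e : (fun y ↦ S.J y ((f • Y) y)) = f • (fun y ↦ S.J y (Y y)) := by
      ext y
      simp
    ext v
    replace h1 := congrArg (fun A ↦ A v) h1
    replace h2 := congrArg (fun A ↦ A v) h2
    simp only [add_apply, smul_apply, ContinuousLinearMap.smulRight_apply] at h1 h2
    simp only [torsionAux, e, smul_apply, ContinuousLinearMap.comp_apply, sub_apply]
    erw [h1, h2]
    simp only [map_add, map_smul, map_sub, S.J_J]
    module
  add {Y Y'} hY hY' := by
    have h1 := (leviCivita E M).isCovariantDerivativeOnUniv.add
      (S.mdifferentiableAt_J hY) (S.mdifferentiableAt_J hY')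
    have h2 := (leviCivita E M).isCovariantDerivativeOnUniv.add hY hY'
    have e : (fun y ↦ S.J y ((Y + Y') y)) =
        (fun y ↦ S.J y (Y y)) + (fun y ↦ S.J y (Y' y)) := by
      ext y
      simp
    ext v
    replace h1 := congrArg (fun A ↦ A v) h1
    replace h2 := congrArg (fun A ↦ A v) h2
    simp only [add_apply] at h1 h2
    simp only [torsionAux, e, smul_apply, add_apply, ContinuousLinearMap.comp_apply, sub_apply]
    erw [h1, h2]
    simp only [map_add, map_sub]
    module

/-- The intrinsic `U(n)`-torsion as a tensor, `S.torsion x Y X = ξ_X Y = -½ J ((∇_X J) Y)`. -/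
def torsion (x : M) : TangentSpace 𝓘(ℝ, E) x →L[ℝ]
    TangentSpace 𝓘(ℝ, E) x →L[ℝ] TangentSpace 𝓘(ℝ, E) x :=
  TensorialAt.mkHom (fun Y ↦ S.torsionAux Y x) x (S.torsionAux_tensorial x)

/-- The intrinsic `U(n)`-torsion `ξ_X Y = -½ J ((∇_X J) Y)`, with the arguments in the usual
order: `S.xi x X Y = ξ_X Y`. -/
def xi (x : M) (X Y : TangentSpace 𝓘(ℝ, E) x) : TangentSpace 𝓘(ℝ, E) x := S.torsion x Y X

/-- The minimal `U(n)`-connection `∇ + ξ`. -/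
def minimalUConnection :
    CovariantDerivative 𝓘(ℝ, E) E (fun x : M ↦ TangentSpace 𝓘(ℝ, E) x) :=
  (leviCivita E M).addOneForm S.torsion

/-- `S.nablaXi x X Y Z = ((∇ᵁ_X ξ)_Y Z)(x)`, the covariant derivative of `ξ` with respect to the
minimal `U(n)`-connection `∇ᵁ`:
`(∇ᵁ_X ξ)_Y Z = ∇ᵁ_X (ξ_Y Z) - ξ_{∇ᵁ_X Y} Z - ξ_Y (∇ᵁ_X Z)`. -/
def nablaXi (x : M) (X Y Z : TangentSpace 𝓘(ℝ, E) x) : TangentSpace 𝓘(ℝ, E) x :=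
  S.minimalUConnection (fun y ↦ S.xi y (extend E Y y) (extend E Z y)) x X
    - S.xi x (S.minimalUConnection (extend E Y) x X) Z
    - S.xi x Y (S.minimalUConnection (extend E Z) x X)

/-- The `*`-Ricci curvature `Ric*(X,Y) = ∑ i, ⟨R_{X,e_i} JY, J e_i⟩`. -/
def ricciStar {ι : Type*} [Fintype ι] {x : M}
    (e : OrthonormalBasis ι ℝ (TangentSpace 𝓘(ℝ, E) x)) (X Y : TangentSpace 𝓘(ℝ, E) x) : ℝ :=
  ∑ i, ⟪curvature x X (e i) (S.J x Y), S.J x (e i)⟫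

/-- The Hermitian product `⟨v, w⟩ + i ω(v, w)`, where `ω(v, w) = ⟨v, J w⟩`. It is complex linear in
the first argument. -/
def hermitian (x : M) (v w : TangentSpace 𝓘(ℝ, E) x) : ℂ :=
  (⟪v, w⟫ : ℝ) + Complex.I * (⟪v, S.J x w⟫ : ℝ)

/-- The Lie algebra `su(n)` at `x`: the endomorphisms of the tangent space that are skew-symmetric,
complex linear, and of complex trace `½ (tr B - i tr (J B))` zero. -/
def suAlgebra (x : M) : Set (TangentSpace 𝓘(ℝ, E) x →L[ℝ] TangentSpace 𝓘(ℝ, E) x) :=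
  {B | (∀ v w, ⟪B v, w⟫ = -⟪v, B w⟫) ∧ (∀ v, B (S.J x v) = S.J x (B v)) ∧
    LinearMap.trace ℝ (TangentSpace 𝓘(ℝ, E) x) B.toLinearMap = 0 ∧
    LinearMap.trace ℝ (TangentSpace 𝓘(ℝ, E) x) (S.J x ∘L B).toLinearMap = 0}

/-- The orthogonal complement of `su(n)` in `so(2n)`, for the inner product `-tr (A B)`. -/
def suPerp (x : M) : Set (TangentSpace 𝓘(ℝ, E) x →L[ℝ] TangentSpace 𝓘(ℝ, E) x) :=
  {A | (∀ v w, ⟪A v, w⟫ = -⟪v, A w⟫) ∧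
    ∀ B ∈ S.suAlgebra x, LinearMap.trace ℝ (TangentSpace 𝓘(ℝ, E) x) (A ∘L B).toLinearMap = 0}

end AlmostHermitian

/-! ### Special almost Hermitian structures -/

variable (E M) in
/-- A special almost Hermitian structure (`SU(n)`-structure) on the Riemannian manifold `M`:
an orthogonal almost complex structure `J` and a smooth complex volume form `Ψ` (an `n`-form that is
complex linear for `J`) with `⟨⟨Ψ, Ψ⟩⟩ = 1`. -/
structure SpecialStructure (n : ℕ) extends AlmostHermitian E M where
  /-- the complex volume form `Ψ = ψ₊ + i ψ₋` -/
  Ψ : Π x : M, TangentSpace 𝓘(ℝ, E) x [⋀^Fin n]→L[ℝ] ℂ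
  /-- `Ψ` is smooth: it takes smooth vector fields to smooth functions, locally. -/
  smooth_Ψ : ∀ (x : M) (Y : Fin n → Π x : M, TangentSpace 𝓘(ℝ, E) x),
    (∀ i, CMDiffAt ∞ (T% (Y i)) x) →
    ContMDiffAt 𝓘(ℝ, E) 𝓘(ℝ, ℂ) ∞ (fun y ↦ Ψ y (fun i ↦ Y i y)) x
  Ψ_J : ∀ (x : M) (v : Fin n → TangentSpace 𝓘(ℝ, E) x) (i : Fin n),
    Ψ x (Function.update v i (J x (v i))) = Complex.I * Ψ x v
  /-- `⟨⟨Ψ, Ψ⟩⟩ = (1/n!) ∑ |Ψ(u_{k 1}, …, u_{k n})|² = 1` for unitary bases `u`. -/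
  norm_Ψ : ∀ (x : M) (u : Fin n → TangentSpace 𝓘(ℝ, E) x),
    (∀ i j, toAlmostHermitian.hermitian x (u i) (u j) = if i = j then 1 else 0) →
    ((n.factorial : ℝ))⁻¹ * ∑ k : Fin n → Fin n, ‖Ψ x (fun i ↦ u (k i))‖ ^ 2 = 1

namespace SpecialStructure

variable {n : ℕ} (S : SpecialStructure E M n)

/-- The difference `A = D - ∇` of a connection and the Levi-Civita connection,
`connectionDifference D x X Y = A_X Y`. -/
def connectionDifference
    (D : CovariantDerivative 𝓘(ℝ, E) E (fun x : M ↦ TangentSpace 𝓘(ℝ, E) x))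
    (x : M) (X : TangentSpace 𝓘(ℝ, E) x) : TangentSpace 𝓘(ℝ, E) x →L[ℝ] TangentSpace 𝓘(ℝ, E) x :=
  (ContinuousLinearMap.apply ℝ (TangentSpace 𝓘(ℝ, E) x) X) ∘L
    (D.difference (leviCivita E M) x)

/-- `D` is the minimal `SU(n)`-connection: the metric, `J` and `Ψ` are `D`-parallel, and `D - ∇`
takes its values in the orthogonal complement of `su(n)` in `so(2n)`. -/
structure IsMinimalSUConnection
    (D : CovariantDerivative 𝓘(ℝ, E) E (fun x : M ↦ TangentSpace 𝓘(ℝ, E) x)) : Prop where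
  metric : ∀ (x : M) (Y Z : Π x : M, TangentSpace 𝓘(ℝ, E) x),
    MDiffAt (T% Y) x → MDiffAt (T% Z) x → ∀ v : TangentSpace 𝓘(ℝ, E) x,
    d% (fun y ↦ ⟪Y y, Z y⟫) x v = ⟪D Y x v, Z x⟫ + ⟪Y x, D Z x v⟫
  parallel_J : ∀ (x : M) (Y : Π x : M, TangentSpace 𝓘(ℝ, E) x),
    MDiffAt (T% Y) x → ∀ v : TangentSpace 𝓘(ℝ, E) x,
    D (fun y ↦ S.J y (Y y)) x v = S.J x (D Y x v)
  parallel_Ψ : ∀ (x : M) (Y : Fin n → Π x : M, TangentSpace 𝓘(ℝ, E) x),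
    (∀ i, MDiffAt (T% (Y i)) x) → ∀ v : TangentSpace 𝓘(ℝ, E) x,
    d% (fun y ↦ S.Ψ y (fun i ↦ Y i y)) x v =
      ∑ i, S.Ψ x (Function.update (fun j ↦ Y j x) i (D (Y i) x v))
  mem_suPerp : ∀ (x : M) (X : TangentSpace 𝓘(ℝ, E) x),
    connectionDifference D x X ∈ S.suPerp x

/-- The part `η = D - ∇ - ξ` of the intrinsic `SU(n)`-torsion, `S.eta D x X Y = η_X Y`, where `D` is
the minimal `SU(n)`-connection. -/
def eta (D : CovariantDerivative 𝓘(ℝ, E) E (fun x : M ↦ TangentSpace 𝓘(ℝ, E) x))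
    (x : M) (X : TangentSpace 𝓘(ℝ, E) x) : TangentSpace 𝓘(ℝ, E) x →L[ℝ] TangentSpace 𝓘(ℝ, E) x :=
  connectionDifference D x X -
    (ContinuousLinearMap.apply ℝ (TangentSpace 𝓘(ℝ, E) x) X) ∘L (S.torsion x)

/-- The one-form `η̂` with `η_X Y = η̂(X) J Y`, that is, `η̂(X) = -(1/2n) tr (J η_X)`. -/
def etaHat (D : CovariantDerivative 𝓘(ℝ, E) E (fun x : M ↦ TangentSpace 𝓘(ℝ, E) x))
    (x : M) (X : TangentSpace 𝓘(ℝ, E) x) : ℝ :=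
  -(1 / (2 * n)) *
    LinearMap.trace ℝ (TangentSpace 𝓘(ℝ, E) x) (S.J x ∘L S.eta D x X).toLinearMap

end SpecialStructure

end SpecialAlmostHermitian

end

/-!
Since `Ψ` is parallel for `D`, the complex trace of the curvature of `D` vanishes. The minimal
`U(n)`-connection `∇ᵁ = ∇ + ξ` differs from `D` by `η̂ ⊗ J`, so its curvature `Rᵁ` differs from that
of `D` by `dη̂ ⊗ J`, which gives `∑ ⟨Rᵁ_{X,Y} e_i, J e_i⟩ = 2n dη̂(X,Y)`. Now `R - Rᵁ` is the sum of
terms quadratic in `ξ`, which commute with `J` and contribute `-2 ∑ ⟨ξ_X e_i, ξ_Y J e_i⟩`, and of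
terms that anticommute with `J` and so contribute nothing; as
`2 Ric*(X,Y) = ∑ ⟨R_{X,JY} e_i, J e_i⟩` by the Bianchi identity, the formula for `Ric*` follows. The
difference `Ric - Ric*` only sees the anticommuting part of `R`, that is, the derivatives of `ξ` and
the terms `ξ_{ξ_X Y}`.
-/

noncomputable section

namespace SpecialAlmostHermitian

open Filter Topology Set

local notation "⟪" v ", " w "⟫" => inner ℝ v w

/-! ### Orthogonal complex structures -/

section LinearAlgebra

theorem trace_eq_zero_of_anticommute {K V : Type*} [CommRing K] [NoZeroDivisors K] [CharZero K]
    [AddCommGroup V] [Module K V] {J T : Module.End K V} (hJ : J * J = -1) (hT : T * J = -(J * T)) :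
    LinearMap.trace K V T = 0 := by
  have h := LinearMap.trace_mul_comm K J (T * J)
  rwa [hT, mul_neg, ← mul_assoc, hJ, neg_mul, one_mul, neg_neg, neg_mul, mul_assoc, hT, mul_neg,
    ← mul_assoc, hJ, neg_mul, one_mul, neg_neg, map_neg, CharZero.eq_neg_self_iff] at h

variable {V : Type*} [NormedAddCommGroup V] [InnerProductSpace ℝ V]

theorem inner_map_self_eq_zero_of_skew {A : V → V} (hA : ∀ v w, ⟪A v, w⟫ = -⟪v, A w⟫) (v : V) :
    ⟪A v, v⟫ = (0 : ℝ) := by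
  linarith [hA v v, real_inner_comm v (A v)]

theorem exists_norm_eq_one_orthogonal [FiniteDimensional ℝ V] {ι : Type*} [Fintype ι] (v : ι → V)
    (h : Fintype.card ι < Module.finrank ℝ V) : ∃ w : V, ‖w‖ = 1 ∧ ∀ i, ⟪v i, w⟫ = (0 : ℝ) := by
  let W := Submodule.span ℝ (Set.range v)
  have : Nontrivial Wᗮ := by
    rw [Submodule.nontrivial_iff_ne_bot, ne_eq, Submodule.orthogonal_eq_bot_iff]
    intro htop
    have hle := finrank_range_le_card (R := ℝ) v
    rw [Set.finrank, show Submodule.span ℝ (Set.range v) = ⊤ from htop, finrank_top] at hle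
    exact hle.not_gt h
  obtain ⟨w, hw⟩ := exists_norm_eq Wᗮ zero_le_one
  exact ⟨w, hw, fun i ↦ (W.mem_orthogonal w).1 w.2 _ (Submodule.subset_span ⟨i, rfl⟩)⟩

section Trace

variable [FiniteDimensional ℝ V] {B : V →ₗ[ℝ] V}

theorem trace_eq_zero_of_skew (hB : ∀ v w, ⟪B v, w⟫ = -⟪v, B w⟫) : LinearMap.trace ℝ V B = 0 := by
  rw [B.trace_eq_sum_inner (stdOrthonormalBasis ℝ V)]
  refine Finset.sum_eq_zero fun i _ ↦ ?_
  rw [real_inner_comm, inner_map_self_eq_zero_of_skew hB]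

theorem eq_zero_of_skew_of_trace_sq_eq_zero (hB : ∀ v w, ⟪B v, w⟫ = -⟪v, B w⟫)
    (h : LinearMap.trace ℝ V (B ∘ₗ B) = 0) : B = 0 := by
  let e := stdOrthonormalBasis ℝ V
  have hsum : ∑ i, ‖B (e i)‖ ^ 2 = 0 := by
    rw [← neg_eq_zero, ← h, LinearMap.trace_eq_sum_inner _ e, ← Finset.sum_neg_distrib]
    refine Finset.sum_congr rfl fun i _ ↦ ?_
    rw [← real_inner_self_eq_norm_sq, hB, neg_neg, LinearMap.comp_apply]
  rw [Finset.sum_eq_zero_iff_of_nonneg fun i _ ↦ by positivity] at hsum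
  refine e.toBasis.ext fun i ↦ ?_
  simpa using hsum i (Finset.mem_univ i)

end Trace

/-- `J` is an orthogonal complex structure on the inner product space `V`. -/
structure IsOrthogonalComplexStructure (J : V →ₗ[ℝ] V) : Prop where
  map_map : ∀ v, J (J v) = -v
  inner_map_map : ∀ v w, ⟪J v, J w⟫ = ⟪v, w⟫

/-- The vectors `u i` are orthonormal for the Hermitian product `⟪v, w⟫ + i ⟪v, J w⟫`. -/
structure IsUnitary {ι : Type*} (J : V →ₗ[ℝ] V) (u : ι → V) : Prop where
  orthonormal : Orthonormal ℝ u
  inner_map : ∀ i j, ⟪u i, J (u j)⟫ = (0 : ℝ)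

/-- The complex trace of a `J`-linear endomorphism `B`, expressed by real traces. -/
def complexTrace (J B : V →ₗ[ℝ] V) : ℂ :=
  (LinearMap.trace ℝ V B - Complex.I * LinearMap.trace ℝ V (J ∘ₗ B)) / 2

theorem complexTrace_im (J B : V →ₗ[ℝ] V) :
    (complexTrace J B).im = -LinearMap.trace ℝ V (J ∘ₗ B) / 2 := by
  simp [complexTrace]

namespace IsOrthogonalComplexStructure

variable {J : V →ₗ[ℝ] V} (hJ : IsOrthogonalComplexStructure J)
include hJ

theorem inner_map_left (v w : V) : ⟪J v, w⟫ = -⟪v, J w⟫ := by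
  rw [← hJ.inner_map_map v, hJ.map_map, inner_neg_right, neg_neg]

theorem inner_map_eq_zero {A : V → V} (hA : ∀ v w, ⟪A v, w⟫ = -⟪v, A w⟫)
    (hAJ : ∀ v, A (J v) = -J (A v)) (v : V) : ⟪A v, J v⟫ = (0 : ℝ) := by
  have h := hA v (J v)
  rw [hAJ, inner_neg_right, neg_neg, ← neg_neg ⟪v, _⟫, ← hJ.inner_map_left] at h
  linarith [real_inner_comm (J v) (A v)]

theorem sum_inner_eq_trace {ι : Type*} [Fintype ι] (e : OrthonormalBasis ι ℝ V) (B : V →ₗ[ℝ] V) :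
    ∑ i, ⟪B (e i), J (e i)⟫ = -LinearMap.trace ℝ V (J ∘ₗ B) := by
  rw [LinearMap.trace_eq_sum_inner _ e, ← Finset.sum_neg_distrib]
  refine Finset.sum_congr rfl fun i _ ↦ ?_
  rw [LinearMap.comp_apply, real_inner_comm, hJ.inner_map_left]

theorem sum_inner_map_J {ι : Type*} [Fintype ι] (e : OrthonormalBasis ι ℝ V) (A : V →ₗ[ℝ] V) :
    ∑ i, ⟪A (J (e i)), e i⟫ = -∑ i, ⟪A (e i), J (e i)⟫ := by
  rw [hJ.sum_inner_eq_trace, neg_neg, ← Module.End.mul_eq_comp, LinearMap.trace_mul_comm,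
    LinearMap.trace_eq_sum_inner _ e]
  simp only [Module.End.mul_apply, real_inner_comm]

theorem orthonormal_sumElim {ι : Type*} {u : ι → V} (hu : IsUnitary J u) :
    Orthonormal ℝ (Sum.elim u (J ∘ u)) := by
  classical
  have hon := orthonormal_iff_ite.1 hu.orthonormal
  rw [orthonormal_iff_ite]
  rintro (i | i) (j | j)
  · simpa using hon i j
  · simpa using hu.inner_map i j
  · simpa [real_inner_comm] using hu.inner_map j i
  · simpa [hJ.inner_map_map] using hon i j

variable [FiniteDimensional ℝ V]

theorem exists_isUnitary (k : ℕ) (hk : 2 * k ≤ Module.finrank ℝ V) :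
    ∃ u : Fin k → V, IsUnitary J u := by
  induction k with
  | zero => exact ⟨Fin.elim0, ⟨⟨fun i ↦ i.elim0, fun i ↦ i.elim0⟩, fun i ↦ i.elim0⟩⟩
  | succ k ih =>
    obtain ⟨u, hu⟩ := ih (by omega)
    obtain ⟨w, hw, hwu⟩ := exists_norm_eq_one_orthogonal (Sum.elim u (J ∘ u)) (by
      rw [Fintype.card_sum, Fintype.card_fin]
      omega)
    have hw_inl (i) : ⟪w, u i⟫ = (0 : ℝ) := (real_inner_comm _ _).trans (hwu (Sum.inl i))
    have hw_inr (i) : ⟪w, J (u i)⟫ = (0 : ℝ) := (real_inner_comm _ _).trans (hwu (Sum.inr i))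
    refine ⟨Matrix.vecCons w u, orthonormal_vecCons_iff.2 ⟨hw, hw_inl, hu.orthonormal⟩,
      Fin.forall_fin_succ.2 ⟨Fin.forall_fin_succ.2 ⟨?_, hw_inr⟩,
        fun i ↦ Fin.forall_fin_succ.2 ⟨?_, hu.inner_map i⟩⟩⟩
    · exact (real_inner_comm _ _).trans (inner_map_self_eq_zero_of_skew hJ.inner_map_left w)
    · exact (real_inner_comm _ _).trans
        ((hJ.inner_map_left _ _).trans (neg_eq_zero.2 (hw_inr i)))

variable {ι : Type*} [Fintype ι] {u : ι → V} {B : V →ₗ[ℝ] V}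

/-- The orthonormal basis formed by the vectors `u i` and `J (u i)` of a unitary basis `u`. -/
def orthonormalBasis (hu : IsUnitary J u)
    (hcard : Module.finrank ℝ V = 2 * Fintype.card ι) : OrthonormalBasis (ι ⊕ ι) ℝ V :=
  .mk (hJ.orthonormal_sumElim hu)
    ((hJ.orthonormal_sumElim hu).linearIndependent.span_eq_top_of_card_eq_finrank' (by
      rw [hcard, Fintype.card_sum, two_mul])).ge

theorem coe_orthonormalBasis (hu : IsUnitary J u)
    (hcard : Module.finrank ℝ V = 2 * Fintype.card ι) :
    ⇑(hJ.orthonormalBasis hu hcard) = Sum.elim u (J ∘ u) :=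
  OrthonormalBasis.coe_mk _ _

theorem complexTrace_eq_sum (hu : IsUnitary J u)
    (hcard : Module.finrank ℝ V = 2 * Fintype.card ι) (hBJ : ∀ v, B (J v) = J (B v)) :
    complexTrace J B =
      ∑ i, ((⟪u i, B (u i)⟫ : ℝ) + Complex.I * (⟪J (u i), B (u i)⟫ : ℝ)) := by
  have htr (A : V →ₗ[ℝ] V) (hAJ : ∀ v, A (J v) = J (A v)) :
      LinearMap.trace ℝ V A = 2 * ∑ i, ⟪u i, A (u i)⟫ := by
    rw [LinearMap.trace_eq_sum_inner _ (hJ.orthonormalBasis hu hcard)]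
    simp only [hJ.coe_orthonormalBasis, Fintype.sum_sum_type, Sum.elim_inl, Sum.elim_inr,
      Function.comp_apply, hAJ, hJ.inner_map_map]
    ring
  rw [complexTrace, htr B hBJ, htr (J ∘ₗ B) fun v ↦ by simp only [LinearMap.comp_apply, hBJ],
    Finset.sum_add_distrib, ← Finset.mul_sum]
  simp only [LinearMap.comp_apply, hJ.inner_map_left]
  push_cast
  simp only [Finset.sum_neg_distrib]
  ring

variable [DecidableEq ι]

theorem map_update_eq_mul (hu : IsUnitary J u)
    (hcard : Module.finrank ℝ V = 2 * Fintype.card ι) {φ : V [⋀^ι]→ₗ[ℝ] ℂ}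
    (hφ : ∀ v i, φ (Function.update v i (J (v i))) = Complex.I * φ v) (i : ι) (w : V) :
    φ (Function.update u i w) = ((⟪u i, w⟫ : ℝ) + Complex.I * (⟪J (u i), w⟫ : ℝ)) * φ u := by
  let L := φ.toMultilinearMap.toLinearMap u i
  have hLu (k) : L (u k) = if k = i then φ u else 0 := by
    split_ifs with hk
    · rw [hk]
      exact congrArg φ (Function.update_eq_self i u)
    · exact φ.map_eq_zero_of_eq _ (by simp [hk]) hk
  have hLJ (k) : L (J (u k)) = Complex.I * L (u k) := by
    have h := hφ (Function.update u i (u k)) i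
    rwa [Function.update_idem, Function.update_self] at h
  have hexp := congrArg L ((hJ.orthonormalBasis hu hcard).sum_repr' w)
  simp only [map_add, map_sum, map_smul, hJ.coe_orthonormalBasis, Fintype.sum_sum_type,
    Sum.elim_inl, Sum.elim_inr, Function.comp_apply, hLJ, hLu, mul_ite, mul_zero, smul_ite,
    smul_zero, Finset.sum_ite_eq', Finset.mem_univ, if_true, Complex.real_smul] at hexp
  calc φ (Function.update u i w) = L w := rfl
    _ = _ := by rw [← hexp]; ring

theorem sum_map_update_eq_complexTrace_mul (hu : IsUnitary J u)
    (hcard : Module.finrank ℝ V = 2 * Fintype.card ι) {φ : V [⋀^ι]→ₗ[ℝ] ℂ}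
    (hφ : ∀ v i, φ (Function.update v i (J (v i))) = Complex.I * φ v)
    (hBJ : ∀ v, B (J v) = J (B v)) :
    ∑ i, φ (Function.update u i (B (u i))) = complexTrace J B * φ u := by
  rw [hJ.complexTrace_eq_sum hu hcard hBJ, Finset.sum_mul]
  exact Finset.sum_congr rfl fun i _ ↦ hJ.map_update_eq_mul hu hcard hφ i (B (u i))

end IsOrthogonalComplexStructure

end LinearAlgebra

variable {E : Type*} [NormedAddCommGroup E] [NormedSpace ℝ E]
  {F : Type*} [NormedAddCommGroup F] [NormedSpace ℝ F]
  {M : Type*} [TopologicalSpace M] [ChartedSpace E M]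

/-! ### Smoothness of vector fields -/

section ChartDerivative

variable {f : M → F} {X Y : Π x : M, TangentSpace 𝓘(ℝ, E) x} {x : M}

theorem contDiffAt_comp_extChartAt_symm_iff :
    ContDiffAt ℝ ∞ (f ∘ (extChartAt 𝓘(ℝ, E) x).symm) (extChartAt 𝓘(ℝ, E) x x) ↔
      ContMDiffAt 𝓘(ℝ, E) 𝓘(ℝ, F) ∞ f x := by
  rw [contMDiffAt_iff_source, modelWithCornersSelf_coe, range_id, contMDiffWithinAt_univ,
    contMDiffAt_iff_contDiffAt]

variable [IsManifold 𝓘(ℝ, E) ∞ M]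

theorem eventually_mdifferentiableAt (hf : ContMDiffAt 𝓘(ℝ, E) 𝓘(ℝ, F) ∞ f x) :
    ∀ᶠ y in 𝓝 x, MDiffAt f y := by
  have : IsManifold 𝓘(ℝ, E) 1 M := .of_le (n := ∞) (by simp)
  filter_upwards [(contMDiffAt_iff_contMDiffAt_nhds (by simp)).1 (hf.of_le (m := 1) (by simp))]
    with y hy
  exact hy.mdifferentiableAt one_ne_zero

theorem eventually_mdifferentiableAt_section (hX : CMDiffAt ∞ (T% X) x) :
    ∀ᶠ y in 𝓝 x, MDiffAt (T% X) y := by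
  have : IsManifold 𝓘(ℝ, E) 1 M := .of_le (n := ∞) (by simp)
  filter_upwards [(contMDiffAt_iff_contMDiffAt_nhds (by simp)).1 (hX.of_le (m := 1) (by simp))]
    with y hy
  exact hy.mdifferentiableAt one_ne_zero

omit [IsManifold 𝓘(ℝ, E) ∞ M] in
variable (X x) in
/-- The vector field `X` read in the preferred chart at `x`. -/
def vectorFieldInChart : E → E :=
  mpullback 𝓘(ℝ, E) 𝓘(ℝ, E) (extChartAt 𝓘(ℝ, E) x).symm X

theorem contDiffAt_vectorFieldInChart [CompleteSpace E] (hX : CMDiffAt ∞ (T% X) x) :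
    ContDiffAt ℝ ∞ (vectorFieldInChart X x) (extChartAt 𝓘(ℝ, E) x x) := by
  have := contMDiffWithinAt_mpullbackWithin_extChartAt_symm (n := ∞)
    (contMDiffWithinAt_univ.2 hX) uniqueMDiffOn_univ (mem_univ x) le_rfl
  rw [preimage_univ, inter_univ, modelWithCornersSelf_coe, range_id, mpullbackWithin_univ] at this
  exact contMDiffAt_vectorSpace_iff_contDiffAt.1
    (this.contMDiffAt (extChartAt_target_mem_nhds x))

theorem mvfderiv_eq_fderiv_inChart {u : E} (hu : u ∈ (extChartAt 𝓘(ℝ, E) x).target)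
    (hf : MDiffAt f ((extChartAt 𝓘(ℝ, E) x).symm u)) :
    d% f ((extChartAt 𝓘(ℝ, E) x).symm u) (X ((extChartAt 𝓘(ℝ, E) x).symm u)) =
      fderiv ℝ (f ∘ (extChartAt 𝓘(ℝ, E) x).symm) u (vectorFieldInChart X x u) := by
  have : IsManifold 𝓘(ℝ, E) 1 M := .of_le (n := ∞) (by simp)
  have hinv := isInvertible_mfderivWithin_extChartAt_symm hu
  have hφ := mdifferentiableWithinAt_extChartAt_symm (I := 𝓘(ℝ, E)) hu
  simp only [modelWithCornersSelf_coe, range_id, mdifferentiableWithinAt_univ,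
    mfderivWithin_univ] at hφ hinv
  rw [vectorFieldInChart, mpullback_apply, ← mfderiv_eq_fderiv, mfderiv_comp u hf hφ]
  exact congrArg (mfderiv% f ((extChartAt 𝓘(ℝ, E) x).symm u)) (hinv.self_apply_inverse _).symm

theorem mvfderiv_eq_fderiv_inChart_self (hf : MDiffAt f x) :
    d% f x (X x) = fderiv ℝ (f ∘ (extChartAt 𝓘(ℝ, E) x).symm) (extChartAt 𝓘(ℝ, E) x x)
      (vectorFieldInChart X x (extChartAt 𝓘(ℝ, E) x x)) := by
  have := mvfderiv_eq_fderiv_inChart (f := f) (X := X) (mem_extChartAt_target x)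
  rw [extChartAt_to_inv] at this
  exact this hf

theorem eventually_mvfderiv_eq_fderiv_inChart (hf : ContMDiffAt 𝓘(ℝ, E) 𝓘(ℝ, F) ∞ f x) :
    (fun y ↦ d% f y (X y)) ∘ (extChartAt 𝓘(ℝ, E) x).symm =ᶠ[𝓝 (extChartAt 𝓘(ℝ, E) x x)]
      fun u ↦ fderiv ℝ (f ∘ (extChartAt 𝓘(ℝ, E) x).symm) u (vectorFieldInChart X x u) := by
  have hc := continuousAt_extChartAt_symm (I := 𝓘(ℝ, E)) x
  rw [ContinuousAt, extChartAt_to_inv] at hc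
  filter_upwards [hc.eventually (eventually_mdifferentiableAt hf),
    extChartAt_target_mem_nhds (I := 𝓘(ℝ, E)) x] with u hfu hu
  exact mvfderiv_eq_fderiv_inChart hu hfu

theorem contMDiffAt_mvfderiv_apply [CompleteSpace E] (hf : ContMDiffAt 𝓘(ℝ, E) 𝓘(ℝ, F) ∞ f x)
    (hX : CMDiffAt ∞ (T% X) x) :
    ContMDiffAt 𝓘(ℝ, E) 𝓘(ℝ, F) ∞ (fun y ↦ d% f y (X y)) x :=
  contDiffAt_comp_extChartAt_symm_iff.1 <|
    (((contDiffAt_comp_extChartAt_symm_iff.2 hf).fderiv_right (by simp)).clm_apply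
      (contDiffAt_vectorFieldInChart hX)).congr_of_eventuallyEq
      (eventually_mvfderiv_eq_fderiv_inChart hf)

theorem mvfderiv_mvfderiv_eq_fderiv_inChart [CompleteSpace E]
    (hf : ContMDiffAt 𝓘(ℝ, E) 𝓘(ℝ, F) ∞ f x) (hY : CMDiffAt ∞ (T% Y) x) :
    d% (fun y ↦ d% f y (Y y)) x (X x) =
      fderiv ℝ (fun u ↦ fderiv ℝ (f ∘ (extChartAt 𝓘(ℝ, E) x).symm) u (vectorFieldInChart Y x u))
        (extChartAt 𝓘(ℝ, E) x x) (vectorFieldInChart X x (extChartAt 𝓘(ℝ, E) x x)) := by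
  rw [mvfderiv_eq_fderiv_inChart_self
    ((contMDiffAt_mvfderiv_apply hf hY).mdifferentiableAt (by simp)),
    (eventually_mvfderiv_eq_fderiv_inChart hf).fderiv_eq]

theorem vectorFieldInChart_mlieBracket [CompleteSpace E]
    (hX : CMDiffAt ∞ (T% X) x) (hY : CMDiffAt ∞ (T% Y) x) :
    vectorFieldInChart (mlieBracket 𝓘(ℝ, E) X Y) x (extChartAt 𝓘(ℝ, E) x x) =
      lieBracket ℝ (vectorFieldInChart X x) (vectorFieldInChart Y x)
        (extChartAt 𝓘(ℝ, E) x x) := by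
  have : IsManifold 𝓘(ℝ, E) (minSmoothness ℝ 3) M :=
    .of_le (n := ∞) (by simpa using ENat.LEInfty.out)
  have hφ : CMDiffAt ∞ (extChartAt 𝓘(ℝ, E) x).symm (extChartAt 𝓘(ℝ, E) x x) :=
    (contMDiffOn_extChartAt_symm x).contMDiffAt (extChartAt_target_mem_nhds x)
  rw [← lieBracketWithin_univ]
  refine (mpullback_mlieBracket ?_ ?_ hφ (by simpa using ENat.LEInfty.out)).trans
    (congrFun mlieBracketWithin_eq_lieBracketWithin _)
  all_goals rw [extChartAt_to_inv]
  exacts [hX.mdifferentiableAt (by simp), hY.mdifferentiableAt (by simp)]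

theorem contMDiffAt_mlieBracket [CompleteSpace E]
    (hX : CMDiffAt ∞ (T% X) x) (hY : CMDiffAt ∞ (T% Y) x) :
    CMDiffAt ∞ (T% (mlieBracket 𝓘(ℝ, E) X Y)) x :=
  have : IsManifold 𝓘(ℝ, E) (minSmoothness ℝ 2) M :=
    .of_le (n := ∞) (by simpa using ENat.LEInfty.out)
  have : IsManifold 𝓘(ℝ, E) ((⊤ : ℕ∞) + 1 : WithTop ℕ∞) M := by
    simpa using (inferInstance : IsManifold 𝓘(ℝ, E) ∞ M)
  hX.mlieBracket_vectorField hY (m := ⊤) (n := ⊤) (by simp)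

theorem mvfderiv_mlieBracket [CompleteSpace E] (hf : ContMDiffAt 𝓘(ℝ, E) 𝓘(ℝ, F) ∞ f x)
    (hX : CMDiffAt ∞ (T% X) x) (hY : CMDiffAt ∞ (T% Y) x) :
    d% f x (mlieBracket 𝓘(ℝ, E) X Y x) =
      d% (fun y ↦ d% f y (Y y)) x (X x) - d% (fun y ↦ d% f y (X y)) x (Y x) := by
  rw [mvfderiv_mvfderiv_eq_fderiv_inChart hf hX, mvfderiv_mvfderiv_eq_fderiv_inChart hf hY,
    mvfderiv_eq_fderiv_inChart_self (hf.mdifferentiableAt (by simp)),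
    vectorFieldInChart_mlieBracket hX hY]
  exact fderiv_apply_lieBracket (contDiffAt_comp_extChartAt_symm_iff.2 hf)
    (by simpa using ENat.LEInfty.out)
    ((contDiffAt_vectorFieldInChart hY).differentiableAt (by simp))
    ((contDiffAt_vectorFieldInChart hX).differentiableAt (by simp))

end ChartDerivative

section InnerProduct

theorem det_gram_mul_repr {ι V : Type*} [Fintype ι] [DecidableEq ι] [NormedAddCommGroup V]
    [InnerProductSpace ℝ V] (b : Module.Basis ι ℝ V) (v : V) (i : ι) :
    (Matrix.gram ℝ b).det * b.repr v i =
      ((Matrix.gram ℝ b).updateCol i fun j ↦ ⟪b j, v⟫).det := by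
  have h : (Matrix.gram ℝ b).mulVec (b.repr v) = fun j ↦ ⟪b j, v⟫ := by
    ext j
    conv_rhs => rw [← b.sum_repr v]
    simp only [Matrix.mulVec, dotProduct, Matrix.gram_apply, inner_sum, real_inner_smul_right,
      mul_comm]
  rw [← Matrix.cramer_apply, ← h, Matrix.cramer_eq_adjugate_mulVec, Matrix.mulVec_mulVec,
    Matrix.adjugate_mul, Matrix.smul_mulVec, Matrix.one_mulVec, Pi.smul_apply, smul_eq_mul]

theorem contMDiffAt_det {ι : Type*} [Fintype ι] [DecidableEq ι] {A : M → Matrix ι ι ℝ} {x : M}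
    (hA : ∀ i j, ContMDiffAt 𝓘(ℝ, E) 𝓘(ℝ, ℝ) ∞ (fun y ↦ A y i j) x) :
    ContMDiffAt 𝓘(ℝ, E) 𝓘(ℝ, ℝ) ∞ (fun y ↦ (A y).det) x := by
  simp only [Matrix.det_apply']
  exact .sum fun σ _ ↦ contMDiffAt_const.mul (contMDiffAt_finsetProd fun i _ ↦ hA _ _)

variable [IsManifold 𝓘(ℝ, E) ∞ M]
  [RiemannianBundle (fun x : M ↦ TangentSpace 𝓘(ℝ, E) x)]
  [IsContMDiffRiemannianBundle 𝓘(ℝ, E) ∞ E (fun x : M ↦ TangentSpace 𝓘(ℝ, E) x)]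
  {X Y Z : Π x : M, TangentSpace 𝓘(ℝ, E) x} {x : M}

theorem contMDiffAt_inner (hX : CMDiffAt ∞ (T% X) x) (hY : CMDiffAt ∞ (T% Y) x) :
    ContMDiffAt 𝓘(ℝ, E) 𝓘(ℝ, ℝ) ∞ (fun y ↦ ⟪X y, Y y⟫) x :=
  ContMDiffAt.inner_bundle (F := E) (E := fun x : M ↦ TangentSpace 𝓘(ℝ, E) x) (b := id) hX hY

variable [FiniteDimensional ℝ E]

theorem contMDiffAt_of_contMDiffAt_inner
    (h : ∀ W : Π x : M, TangentSpace 𝓘(ℝ, E) x, CMDiffAt ∞ (T% W) x →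
      ContMDiffAt 𝓘(ℝ, E) 𝓘(ℝ, ℝ) ∞ (fun y ↦ ⟪W y, Z y⟫) x) : CMDiffAt ∞ (T% Z) x := by
  classical
  set e := trivializationAt E (fun x : M ↦ TangentSpace 𝓘(ℝ, E) x) x
  have hx : x ∈ e.baseSet := mem_baseSet_trivializationAt E (fun x : M ↦ TangentSpace 𝓘(ℝ, E) x) x
  set s := e.localFrame (Module.finBasis ℝ E)
  have hframe := e.isLocalFrameOn_localFrame_baseSet 𝓘(ℝ, E) ∞ (Module.finBasis ℝ E)
  have hs i : CMDiffAt ∞ (T% (s i)) x := hframe.contMDiffAt e.open_baseSet hx i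
  set G : M → Matrix _ _ ℝ := fun y ↦ Matrix.gram ℝ fun i ↦ s i y
  have hG i j : ContMDiffAt 𝓘(ℝ, E) 𝓘(ℝ, ℝ) ∞ (fun y ↦ G y i j) x :=
    contMDiffAt_inner (hs i) (hs j)
  have hdet {y} (hy : y ∈ e.baseSet) : (G y).det ≠ 0 :=
    Matrix.det_gram_ne_zero_iff_linearIndependent.2 (hframe.linearIndependent hy)
  refine hframe.contMDiffAt_of_coeff (fun i ↦ ?_) (e.open_baseSet.mem_nhds hx)
  have hnum : ContMDiffAt 𝓘(ℝ, E) 𝓘(ℝ, ℝ) ∞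
      (fun y ↦ ((G y).updateCol i fun j ↦ ⟪s j y, Z y⟫).det) x := by
    refine contMDiffAt_det fun j k ↦ ?_
    obtain rfl | hk := eq_or_ne k i
    · simpa using h _ (hs j)
    · simpa [hk] using hG j k
  refine (hnum.div₀ (contMDiffAt_det hG) (hdet hx)).congr_of_eventuallyEq ?_
  filter_upwards [e.open_baseSet.mem_nhds hx] with y hy
  rw [Pi.div_apply, eq_div_iff (hdet hy), mul_comm]
  have hb : ⇑(hframe.toBasisAt hy) = fun i ↦ s i y := funext (hframe.toBasisAt_coe hy)
  have := det_gram_mul_repr (hframe.toBasisAt hy) (Z y) i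
  rwa [hb, ← hframe.coeff_apply_of_mem hy] at this

theorem contMDiffAt_leviCivita (hZ : CMDiffAt ∞ (T% Z) x) (hX : CMDiffAt ∞ (T% X) x) :
    CMDiffAt ∞ (T% (fun y ↦ leviCivita E M Z y (X y))) x := by
  refine contMDiffAt_of_contMDiffAt_inner fun W hW ↦ ?_
  have hk : ContMDiffAt 𝓘(ℝ, E) 𝓘(ℝ, ℝ) ∞ (koszul Z X W) x :=
    (((((contMDiffAt_mvfderiv_apply (contMDiffAt_inner hZ hW) hX).add
      (contMDiffAt_mvfderiv_apply (contMDiffAt_inner hX hW) hZ)).sub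
      (contMDiffAt_mvfderiv_apply (contMDiffAt_inner hX hZ) hW)).add
      (contMDiffAt_inner (contMDiffAt_mlieBracket hX hZ) hW)).sub
      (contMDiffAt_inner (contMDiffAt_mlieBracket hX hW) hZ)).sub
      (contMDiffAt_inner (contMDiffAt_mlieBracket hZ hW) hX)
  refine ((contMDiffAt_const (c := 2⁻¹)).mul hk).congr_of_eventuallyEq ?_
  filter_upwards [eventually_mdifferentiableAt_section hZ, eventually_mdifferentiableAt_section hX,
    eventually_mdifferentiableAt_section hW] with y hZy hXy hWy
  rw [real_inner_comm]
  exact inner_leviCivitaAux hZy hXy hWy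

end InnerProduct

/-! ### Curvature of metric connections -/

section Connections

variable {f g : M → F} {X Y Z W : Π x : M, TangentSpace 𝓘(ℝ, E) x} {x : M}

theorem mvfderiv_apply_congr (h : ∀ᶠ y in 𝓝 x, f y = g y) (v : TangentSpace 𝓘(ℝ, E) x) :
    d% f x v = d% g x v :=
  congrArg (fun A : TangentSpace 𝓘(ℝ, E) x →L[ℝ] F ↦ A v)
    (EventuallyEq.mfderiv_eq (I := 𝓘(ℝ, E)) h)

variable [IsManifold 𝓘(ℝ, E) ∞ M]

variable (E M) in
/-- A connection on the tangent bundle of `M`, in Mathlib's argument order: `D Y x v` is the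
derivative of the vector field `Y` at `x` in the direction `v`. -/
abbrev Connection := CovariantDerivative 𝓘(ℝ, E) E (fun x : M ↦ TangentSpace 𝓘(ℝ, E) x)

/-- The connection `D` maps vector fields that are smooth at a point to vector fields that are
smooth at this point. -/
def IsSmoothConnection (D : Connection E M) : Prop :=
  ∀ ⦃x : M⦄ ⦃Z X : Π x : M, TangentSpace 𝓘(ℝ, E) x⦄, CMDiffAt ∞ (T% Z) x → CMDiffAt ∞ (T% X) x →
    CMDiffAt ∞ (T% (fun y ↦ D Z y (X y))) x

/-- The curvature `D_{[X,Y]} Z - D_X D_Y Z + D_Y D_X Z` of a connection on vector fields. -/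
def curvatureOf (D : Connection E M) (X Y Z : Π x : M, TangentSpace 𝓘(ℝ, E) x) (x : M) :
    TangentSpace 𝓘(ℝ, E) x :=
  D Z x (mlieBracket 𝓘(ℝ, E) X Y x) - D (fun y ↦ D Z y (Y y)) x (X x)
    + D (fun y ↦ D Z y (X y)) x (Y x)

variable {D D' : Connection E M}

theorem connection_add (hY : MDiffAt (T% Y) x) (hZ : MDiffAt (T% Z) x) :
    D (fun y ↦ Y y + Z y) x = D Y x + D Z x :=
  D.isCovariantDerivativeOnUniv.add hY hZ

theorem connection_smul {a : M → ℝ} (ha : MDiffAt a x) (hZ : MDiffAt (T% Z) x) :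
    D (fun y ↦ a y • Z y) x = a x • D Z x + (d% a x).smulRight (Z x) :=
  D.isCovariantDerivativeOnUniv.leibniz hZ ha

theorem connection_neg (hZ : MDiffAt (T% Z) x) : D (fun y ↦ -Z y) x = -D Z x := by
  have h := connection_smul (D := D) (a := fun _ ↦ -1) mdifferentiableAt_const hZ
  simpa only [neg_smul, one_smul, mvfderiv_const, ContinuousLinearMap.zero_smulRight,
    add_zero] using h

theorem connection_congr (hY : MDiffAt (T% Y) x) (h : ∀ᶠ y in 𝓝 x, Y y = Z y) :
    D Y x = D Z x := by
  refine D.isCovariantDerivativeOnUniv.congr_of_eventuallyEq hY ?_ univ_mem h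
  exact hY.congr_of_eventuallyEq (h.mono fun y hy ↦ by simp [hy])

theorem connection_eq_sub (hY : MDiffAt (T% Y) x) (hZ : MDiffAt (T% Z) x)
    (h : ∀ᶠ y in 𝓝 x, Y y - Z y = W y) : D W x = D Y x - D Z x := by
  have hYZ := mdifferentiableAt_sub_section hY hZ
  rw [← connection_congr hYZ h, eq_sub_iff_add_eq, ← connection_add hYZ hZ]
  simp only [Pi.sub_apply, sub_add_cancel]

theorem curvatureOf_swap (D : Connection E M) (X Y Z : Π x : M, TangentSpace 𝓘(ℝ, E) x) (x : M) :
    curvatureOf D Y X Z x = -curvatureOf D X Y Z x := by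
  rw [curvatureOf, curvatureOf, mlieBracket_swap_apply, map_neg]
  abel

theorem curvatureOf_eq_of_eq_add {A : Π x : M, TangentSpace 𝓘(ℝ, E) x →L[ℝ]
      TangentSpace 𝓘(ℝ, E) x →L[ℝ] TangentSpace 𝓘(ℝ, E) x}
    (h : ∀ {Z x}, MDiffAt (T% Z) x → D' Z x = D Z x + A x (Z x))
    (hD : IsSmoothConnection D) (hD' : IsSmoothConnection D')
    (hX : CMDiffAt ∞ (T% X) x) (hY : CMDiffAt ∞ (T% Y) x) (hZ : CMDiffAt ∞ (T% Z) x) :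
    curvatureOf D X Y Z x = curvatureOf D' X Y Z x - A x (Z x) (mlieBracket 𝓘(ℝ, E) X Y x)
      + (D' (fun y ↦ A y (Z y) (Y y)) x (X x) + A x (D' Z x (Y x)) (X x)
        - A x (A x (Z x) (Y x)) (X x))
      - (D' (fun y ↦ A y (Z y) (X y)) x (Y x) + A x (D' Z x (X x)) (Y x)
        - A x (A x (Z x) (X x)) (Y x)) := by
  have second_derivative {U V : Π x : M, TangentSpace 𝓘(ℝ, E) x} (hV : CMDiffAt ∞ (T% V) x) :
      D (fun y ↦ D Z y (V y)) x (U x) = D' (fun y ↦ D' Z y (V y)) x (U x)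
        - (D' (fun y ↦ A y (Z y) (V y)) x (U x) + A x (D' Z x (V x)) (U x)
          - A x (A x (Z x) (V x)) (U x)) := by
    have hDV := (hD hZ hV).mdifferentiableAt (by simp)
    have hDV' := (hD' hZ hV).mdifferentiableAt (by simp)
    have hA : ∀ᶠ y in 𝓝 x, D' Z y (V y) - D Z y (V y) = A y (Z y) (V y) := by
      filter_upwards [eventually_mdifferentiableAt_section hZ] with y hy
      rw [h hy, add_apply, add_sub_cancel_left]
    rw [connection_eq_sub hDV' hDV hA, ← hA.self_of_nhds, sub_apply, h hDV, map_sub, sub_apply,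
      add_apply]
    abel
  rw [curvatureOf, curvatureOf, second_derivative hX, second_derivative hY,
    eq_sub_of_add_eq (h (hZ.mdifferentiableAt (by simp))).symm, sub_apply]
  abel

theorem mlieBracket_jacobi [CompleteSpace E] (hX : CMDiffAt ∞ (T% X) x)
    (hY : CMDiffAt ∞ (T% Y) x) (hZ : CMDiffAt ∞ (T% Z) x) :
    mlieBracket 𝓘(ℝ, E) X (mlieBracket 𝓘(ℝ, E) Y Z) x
      + mlieBracket 𝓘(ℝ, E) Y (mlieBracket 𝓘(ℝ, E) Z X) x
      + mlieBracket 𝓘(ℝ, E) Z (mlieBracket 𝓘(ℝ, E) X Y) x = 0 := by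
  have : IsManifold 𝓘(ℝ, E) (minSmoothness ℝ 3) M :=
    .of_le (n := ∞) (by simpa using ENat.LEInfty.out)
  have smooth {V : Π y : M, TangentSpace 𝓘(ℝ, E) y} (hV : CMDiffAt ∞ (T% V) x) :
      CMDiffAt (minSmoothness ℝ 2) (T% V) x := hV.of_le (by simpa using ENat.LEInfty.out)
  have hZX : mlieBracket 𝓘(ℝ, E) Y (mlieBracket 𝓘(ℝ, E) X Z) x =
      -mlieBracket 𝓘(ℝ, E) Y (mlieBracket 𝓘(ℝ, E) Z X) x := by
    rw [mlieBracket_swap (V := X), ← neg_one_smul ℝ, mlieBracket_const_smul_right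
      ((contMDiffAt_mlieBracket hZ hX).mdifferentiableAt (by simp)), neg_one_smul]
  have hXY : mlieBracket 𝓘(ℝ, E) (mlieBracket 𝓘(ℝ, E) X Y) Z x =
    -mlieBracket 𝓘(ℝ, E) Z (mlieBracket 𝓘(ℝ, E) X Y) x := mlieBracket_swap_apply
  rw [leibniz_identity_mlieBracket_apply (smooth hX) (smooth hY) (smooth hZ), hXY, hZX]
  abel

theorem curvatureOf_bianchi [CompleteSpace E] (hs : IsSmoothConnection D)
    (htor : ∀ {X Y x}, MDiffAt (T% X) x → MDiffAt (T% Y) x →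
      D Y x (X x) - D X x (Y x) = mlieBracket 𝓘(ℝ, E) X Y x)
    (hX : CMDiffAt ∞ (T% X) x) (hY : CMDiffAt ∞ (T% Y) x) (hZ : CMDiffAt ∞ (T% Z) x) :
    curvatureOf D X Y Z x + curvatureOf D Y Z X x + curvatureOf D Z X Y x = 0 := by
  have mdiff {V : Π y : M, TangentSpace 𝓘(ℝ, E) y} (hV : CMDiffAt ∞ (T% V) x) :
      MDiffAt (T% V) x := hV.mdifferentiableAt (by simp)
  have second_derivative {U V W : Π x : M, TangentSpace 𝓘(ℝ, E) x} (hU : CMDiffAt ∞ (T% U) x)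
      (hV : CMDiffAt ∞ (T% V) x) (hW : CMDiffAt ∞ (T% W) x) :
      D (fun y ↦ D V y (U y)) x (W x) = D (fun y ↦ D U y (V y)) x (W x)
        + D W x (mlieBracket 𝓘(ℝ, E) U V x)
        + mlieBracket 𝓘(ℝ, E) W (mlieBracket 𝓘(ℝ, E) U V) x := by
    have hUV : ∀ᶠ y in 𝓝 x, D V y (U y) - D U y (V y) = mlieBracket 𝓘(ℝ, E) U V y := by
      filter_upwards [eventually_mdifferentiableAt_section hU,
        eventually_mdifferentiableAt_section hV] with y hUy hVy using htor hUy hVy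
    rw [← htor (mdiff hW) (mdiff (contMDiffAt_mlieBracket hU hV)),
      connection_eq_sub (mdiff (hs hV hU)) (mdiff (hs hU hV)) hUV, sub_apply]
    abel
  rw [← neg_eq_zero, ← mlieBracket_jacobi hX hY hZ, curvatureOf, curvatureOf, curvatureOf,
    second_derivative hY hZ hX, second_derivative hZ hX hY, second_derivative hX hY hZ]
  abel

end Connections

theorem pair_symm_of_bianchi {V : Type*} {R : V → V → V → V → ℝ}
    (hswap : ∀ a b c d, R b a c d = -R a b c d) (hskew : ∀ a b c d, R a b d c = -R a b c d)
    (hbianchi : ∀ a b c d, R a b c d + R b c a d + R c a b d = 0) (a b c d : V) :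
    R a b c d = R c d a b := by
  linarith [hbianchi a b c d, hbianchi b c d a, hbianchi c d a b, hbianchi d a b c,
    hskew b c a d, hskew c a b d, hskew c a d b, hskew c d a b, hskew d a b c, hskew a b c d,
    hskew b d c a, hswap c a b d, hswap c a d b, hswap d b a c, hswap b d c a]

section LinearOfAdjoint

variable {V : Type*} [NormedAddCommGroup V] [InnerProductSpace ℝ V]

/-- A map of an inner product space that has an adjoint, as a linear map. -/
def linearMapOfAdjoint (A B : V → V) (h : ∀ v w, ⟪A v, w⟫ = ⟪v, B w⟫) : V →ₗ[ℝ] V where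
  toFun := A
  map_add' v w := ext_inner_right ℝ fun u ↦ by simp only [h, inner_add_left]
  map_smul' r v := ext_inner_right ℝ fun u ↦ by
    simp only [h, real_inner_smul_left, RingHom.id_apply]

end LinearOfAdjoint

section CurvatureTensor

variable [IsManifold 𝓘(ℝ, E) ∞ M]
  [RiemannianBundle (fun x : M ↦ TangentSpace 𝓘(ℝ, E) x)]
  {D : Connection E M} {X Y Z W : Π x : M, TangentSpace 𝓘(ℝ, E) x} {x : M}

/-- The metric is parallel for the connection `D`. -/
def IsMetricConnection (D : Connection E M) : Prop :=
  ∀ ⦃x : M⦄ ⦃Y Z : Π x : M, TangentSpace 𝓘(ℝ, E) x⦄,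
    MDiffAt (T% Y) x → MDiffAt (T% Z) x → ∀ v : TangentSpace 𝓘(ℝ, E) x,
    d% (fun y ↦ ⟪Y y, Z y⟫) x v = ⟪D Y x v, Z x⟫ + ⟪Y x, D Z x v⟫

variable [IsContMDiffRiemannianBundle 𝓘(ℝ, E) ∞ E (fun x : M ↦ TangentSpace 𝓘(ℝ, E) x)]

theorem mvfderiv_mvfderiv_inner (hs : IsSmoothConnection D) (hm : IsMetricConnection D)
    (hY : CMDiffAt ∞ (T% Y) x) (hZ : CMDiffAt ∞ (T% Z) x) (hW : CMDiffAt ∞ (T% W) x)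
    (v : TangentSpace 𝓘(ℝ, E) x) :
    d% (fun y ↦ d% (fun z ↦ ⟪Z z, W z⟫) y (Y y)) x v =
      ⟪D (fun y ↦ D Z y (Y y)) x v, W x⟫ + ⟪D Z x (Y x), D W x v⟫
        + (⟪D Z x v, D W x (Y x)⟫ + ⟪Z x, D (fun y ↦ D W y (Y y)) x v⟫) := by
  have hfirst : ∀ᶠ y in 𝓝 x, d% (fun z ↦ ⟪Z z, W z⟫) y (Y y) =
      ⟪D Z y (Y y), W y⟫ + ⟪Z y, D W y (Y y)⟫ := by
    filter_upwards [eventually_mdifferentiableAt_section hZ,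
      eventually_mdifferentiableAt_section hW] with y hZy hWy using hm hZy hWy _
  rw [mvfderiv_apply_congr hfirst, mvfderiv_fun_add
    ((contMDiffAt_inner (hs hZ hY) hW).mdifferentiableAt (by simp))
    ((contMDiffAt_inner hZ (hs hW hY)).mdifferentiableAt (by simp)), add_apply,
    hm ((hs hZ hY).mdifferentiableAt (by simp)) (hW.mdifferentiableAt (by simp)),
    hm (hZ.mdifferentiableAt (by simp)) ((hs hW hY).mdifferentiableAt (by simp))]

variable [FiniteDimensional ℝ E]

theorem inner_curvatureOf (hs : IsSmoothConnection D) (hm : IsMetricConnection D)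
    (hX : CMDiffAt ∞ (T% X) x) (hY : CMDiffAt ∞ (T% Y) x) (hZ : CMDiffAt ∞ (T% Z) x)
    (hW : CMDiffAt ∞ (T% W) x) :
    ⟪curvatureOf D X Y Z x, W x⟫ = -⟪Z x, curvatureOf D X Y W x⟫ := by
  have h := mvfderiv_mlieBracket (contMDiffAt_inner hZ hW) hX hY
  rw [mvfderiv_mvfderiv_inner hs hm hX hZ hW, mvfderiv_mvfderiv_inner hs hm hY hZ hW,
    hm (hZ.mdifferentiableAt (by simp)) (hW.mdifferentiableAt (by simp))] at h
  simp only [curvatureOf, inner_sub_left, inner_add_left, inner_sub_right, inner_add_right]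
  linarith

theorem curvatureOf_congr (hs : IsSmoothConnection D) (hm : IsMetricConnection D)
    (hX : CMDiffAt ∞ (T% X) x) (hY : CMDiffAt ∞ (T% Y) x) (hZ : CMDiffAt ∞ (T% Z) x)
    (hW : CMDiffAt ∞ (T% W) x) (h : Z x = W x) :
    curvatureOf D X Y Z x = curvatureOf D X Y W x := by
  refine ext_inner_right ℝ fun v ↦ ?_
  have hv := contMDiffAt_extend 𝓘(ℝ, E) E v (k := ∞)
  rw [← extend_apply_self E v, inner_curvatureOf hs hm hX hY hZ hv,
    inner_curvatureOf hs hm hX hY hW hv, h]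

omit [IsContMDiffRiemannianBundle 𝓘(ℝ, E) ∞ E (fun x : M ↦ TangentSpace 𝓘(ℝ, E) x)]
  [RiemannianBundle (fun x : M ↦ TangentSpace 𝓘(ℝ, E) x)] [FiniteDimensional ℝ E] in
/-- The curvature of a connection on tangent vectors at `x`; `curvature` is the case of the
Levi-Civita connection. -/
def curvatureAt (D : Connection E M) (x : M) (a b c : TangentSpace 𝓘(ℝ, E) x) :
    TangentSpace 𝓘(ℝ, E) x :=
  curvatureOf D (extend E a) (extend E b) (extend E c) x

theorem inner_curvatureAt (hs : IsSmoothConnection D) (hm : IsMetricConnection D)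
    (a b c d : TangentSpace 𝓘(ℝ, E) x) :
    ⟪curvatureAt D x a b c, d⟫ = -⟪c, curvatureAt D x a b d⟫ := by
  have h := inner_curvatureOf hs hm (contMDiffAt_extend 𝓘(ℝ, E) E a)
    (contMDiffAt_extend 𝓘(ℝ, E) E b) (contMDiffAt_extend 𝓘(ℝ, E) E c)
    (contMDiffAt_extend 𝓘(ℝ, E) E d)
  rwa [extend_apply_self, extend_apply_self] at h

theorem curvatureAt_eq_curvatureOf (hs : IsSmoothConnection D) (hm : IsMetricConnection D)
    (a b : TangentSpace 𝓘(ℝ, E) x) (hZ : CMDiffAt ∞ (T% Z) x) :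
    curvatureAt D x a b (Z x) = curvatureOf D (extend E a) (extend E b) Z x :=
  curvatureOf_congr hs hm (contMDiffAt_extend 𝓘(ℝ, E) E a) (contMDiffAt_extend 𝓘(ℝ, E) E b)
    (contMDiffAt_extend 𝓘(ℝ, E) E _) hZ (extend_apply_self E _)

/-- The curvature endomorphism `R_{a,b}` of a smooth metric connection. -/
def curvatureHom (hs : IsSmoothConnection D) (hm : IsMetricConnection D)
    (a b : TangentSpace 𝓘(ℝ, E) x) : TangentSpace 𝓘(ℝ, E) x →ₗ[ℝ] TangentSpace 𝓘(ℝ, E) x :=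
  linearMapOfAdjoint (curvatureAt D x a b) (fun c ↦ -curvatureAt D x a b c)
    fun v w ↦ by rw [inner_neg_right, inner_curvatureAt hs hm]

theorem isSmoothConnection_leviCivita : IsSmoothConnection (leviCivita E M) :=
  fun _ _ _ hZ hX ↦ contMDiffAt_leviCivita hZ hX

theorem isMetricConnection_leviCivita : IsMetricConnection (leviCivita E M) :=
  fun _ _ _ hY hZ v ↦ leviCivita_metric hY hZ v

theorem curvature_swap (a b c : TangentSpace 𝓘(ℝ, E) x) :
    curvature x b a c = -curvature x a b c :=
  curvatureOf_swap (leviCivita E M) _ _ _ _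

theorem inner_curvature_skew (a b c d : TangentSpace 𝓘(ℝ, E) x) :
    ⟪curvature x a b d, c⟫ = -⟪curvature x a b c, d⟫ := by
  rw [real_inner_comm d]
  exact inner_curvatureAt isSmoothConnection_leviCivita isMetricConnection_leviCivita a b d c

theorem curvature_bianchi (a b c : TangentSpace 𝓘(ℝ, E) x) :
    curvature x a b c + curvature x b c a + curvature x c a b = 0 :=
  curvatureOf_bianchi isSmoothConnection_leviCivita leviCivita_torsion
    (contMDiffAt_extend 𝓘(ℝ, E) E a) (contMDiffAt_extend 𝓘(ℝ, E) E b)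
    (contMDiffAt_extend 𝓘(ℝ, E) E c)

theorem inner_curvature_pair_symm (a b c d : TangentSpace 𝓘(ℝ, E) x) :
    ⟪curvature x a b c, d⟫ = ⟪curvature x c d a, b⟫ :=
  pair_symm_of_bianchi (R := fun a b c d ↦ ⟪curvature x a b c, d⟫)
    (fun a b c d ↦ by rw [curvature_swap, inner_neg_left]) inner_curvature_skew
    (fun a b c d ↦ by
      rw [← inner_add_left, ← inner_add_left, curvature_bianchi, inner_zero_left]) a b c d

/-- The endomorphism `v ↦ R_{a,v} c` of the Riemannian curvature. -/
def curvatureMid (a c : TangentSpace 𝓘(ℝ, E) x) :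
    TangentSpace 𝓘(ℝ, E) x →ₗ[ℝ] TangentSpace 𝓘(ℝ, E) x :=
  linearMapOfAdjoint (fun v ↦ curvature x a v c) (fun v ↦ curvature x c v a) fun v w ↦ by
    rw [inner_curvature_pair_symm, real_inner_comm]

end CurvatureTensor

/-! ### Intrinsic torsion of an almost Hermitian structure -/

namespace AlmostHermitian

variable [IsManifold 𝓘(ℝ, E) ∞ M] [RiemannianBundle (fun x : M ↦ TangentSpace 𝓘(ℝ, E) x)]
  (S : AlmostHermitian E M) {X Y Z W : Π x : M, TangentSpace 𝓘(ℝ, E) x} {x : M}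

theorem isOrthogonalComplexStructure (x : M) :
    IsOrthogonalComplexStructure (S.J x).toLinearMap :=
  ⟨S.J_J x, S.inner_J_J x⟩

theorem inner_J_left (x : M) (v w : TangentSpace 𝓘(ℝ, E) x) : ⟪S.J x v, w⟫ = -⟪v, S.J x w⟫ :=
  (S.isOrthogonalComplexStructure x).inner_map_left v w

theorem contMDiffAt_J (hY : CMDiffAt ∞ (T% Y) x) : CMDiffAt ∞ (T% (fun y ↦ S.J y (Y y))) x :=
  (S.smooth_J x).clm_bundle_apply hY

variable [FiniteDimensional ℝ E]
  [IsContMDiffRiemannianBundle 𝓘(ℝ, E) ∞ E (fun x : M ↦ TangentSpace 𝓘(ℝ, E) x)]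

section IntrinsicTorsion

theorem xi_neg_right (x : M) (u v : TangentSpace 𝓘(ℝ, E) x) : S.xi x u (-v) = -S.xi x u v := by
  simp only [xi, map_neg, neg_apply]

theorem xi_apply (hY : MDiffAt (T% Y) x) (v : TangentSpace 𝓘(ℝ, E) x) :
    S.xi x v (Y x) = (-(1 / 2) : ℝ) • S.J x
      (leviCivita E M (fun y ↦ S.J y (Y y)) x v - S.J x (leviCivita E M Y x v)) :=
  congrArg (fun A ↦ A v) (TensorialAt.mkHom_apply (S.torsionAux_tensorial x) hY)

theorem leviCivita_J (hY : MDiffAt (T% Y) x) (v : TangentSpace 𝓘(ℝ, E) x) :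
    leviCivita E M (fun y ↦ S.J y (Y y)) x v =
      S.J x (leviCivita E M Y x v) + (2 : ℝ) • S.J x (S.xi x v (Y x)) := by
  rw [S.xi_apply hY, map_smul, S.J_J]
  module

theorem xi_J (x : M) (v w : TangentSpace 𝓘(ℝ, E) x) : S.xi x v (S.J x w) = -S.J x (S.xi x v w) := by
  have hY : MDiffAt (T% (extend E w)) x := mdifferentiableAt_extend ..
  have hJJ := S.leviCivita_J (S.mdifferentiableAt_J hY) v
  simp only [S.J_J] at hJJ
  rw [connection_neg hY, neg_apply, S.leviCivita_J hY, map_add, map_smul, S.J_J, S.J_J,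
    extend_apply_self] at hJJ
  have h : S.J x (S.xi x v (S.J x w)) = S.xi x v w := by
    refine smul_right_injective _ (two_ne_zero (α := ℝ)) ?_
    change (2 : ℝ) • S.J x (S.xi x v (S.J x w)) = (2 : ℝ) • S.xi x v w
    rw [← sub_eq_zero, ← neg_eq_zero, ← sub_eq_zero.mpr hJJ]
    module
  rw [← h, S.J_J, neg_neg]

theorem inner_J_xi (x : M) (u v w : TangentSpace 𝓘(ℝ, E) x) :
    ⟪S.J x (S.xi x u v), w⟫ = -⟪v, S.J x (S.xi x u w)⟫ := by
  have hV : MDiffAt (T% (extend E v)) x := mdifferentiableAt_extend ..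
  have hW : MDiffAt (T% (extend E w)) x := mdifferentiableAt_extend ..
  have hJV := leviCivita_metric (S.mdifferentiableAt_J hV) hW u
  have hJW := leviCivita_metric hV (S.mdifferentiableAt_J hW) u
  simp only [S.inner_J_left] at hJV
  rw [mvfderiv_fun_neg, neg_apply, hJW, S.leviCivita_J hV, S.leviCivita_J hW] at hJV
  simp only [extend_apply_self, inner_add_left, inner_add_right, real_inner_smul_left,
    real_inner_smul_right, S.inner_J_left] at hJV
  rw [S.inner_J_left]
  linarith

theorem inner_xi (x : M) (u v w : TangentSpace 𝓘(ℝ, E) x) :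
    ⟪S.xi x u v, w⟫ = -⟪v, S.xi x u w⟫ := by
  have h := S.inner_J_xi x u v (S.J x w)
  rwa [S.inner_J_J, S.xi_J, map_neg, S.J_J, neg_neg] at h

theorem contMDiffAt_xi (hX : CMDiffAt ∞ (T% X) x) (hY : CMDiffAt ∞ (T% Y) x) :
    CMDiffAt ∞ (T% (fun y ↦ S.xi y (X y) (Y y))) x := by
  refine (ContMDiffAt.const_smul_section (a := -(1 / 2)) (S.contMDiffAt_J (ContMDiffAt.sub_section
    (contMDiffAt_leviCivita (S.contMDiffAt_J hY) hX)
    (S.contMDiffAt_J (contMDiffAt_leviCivita hY hX))))).congr_of_eventuallyEq ?_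
  filter_upwards [eventually_mdifferentiableAt_section hY] with y hy
  exact congrArg (TotalSpace.mk y) (S.xi_apply hy _)

end IntrinsicTorsion

section MinimalUConnection

theorem minimalUConnection_apply (Y : Π x : M, TangentSpace 𝓘(ℝ, E) x) (x : M)
    (v : TangentSpace 𝓘(ℝ, E) x) :
    S.minimalUConnection Y x v = leviCivita E M Y x v + S.xi x v (Y x) := rfl

theorem isSmoothConnection_minimalUConnection : IsSmoothConnection S.minimalUConnection :=
  fun _ _ _ hZ hX ↦ ContMDiffAt.add_section (contMDiffAt_leviCivita hZ hX) (S.contMDiffAt_xi hX hZ)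

theorem isMetricConnection_minimalUConnection : IsMetricConnection S.minimalUConnection := by
  intro x Y Z hY hZ v
  rw [leviCivita_metric hY hZ v, minimalUConnection_apply, minimalUConnection_apply,
    inner_add_left, inner_add_right, S.inner_xi]
  ring

theorem minimalUConnection_J (hY : MDiffAt (T% Y) x) (v : TangentSpace 𝓘(ℝ, E) x) :
    S.minimalUConnection (fun y ↦ S.J y (Y y)) x v = S.J x (S.minimalUConnection Y x v) := by
  rw [minimalUConnection_apply, minimalUConnection_apply, S.leviCivita_J hY, S.xi_J, map_add]
  module

theorem curvatureOf_minimalUConnection_J (hX : CMDiffAt ∞ (T% X) x) (hY : CMDiffAt ∞ (T% Y) x)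
    (hZ : CMDiffAt ∞ (T% Z) x) :
    curvatureOf S.minimalUConnection X Y (fun y ↦ S.J y (Z y)) x =
      S.J x (curvatureOf S.minimalUConnection X Y Z x) := by
  have hs := S.isSmoothConnection_minimalUConnection
  have second_derivative {U V : Π x : M, TangentSpace 𝓘(ℝ, E) x} (hV : CMDiffAt ∞ (T% V) x) :
      S.minimalUConnection
        (fun y ↦ S.minimalUConnection (fun z ↦ S.J z (Z z)) y (V y)) x (U x) =
      S.J x (S.minimalUConnection (fun y ↦ S.minimalUConnection Z y (V y)) x (U x)) := by
    have hJ : ∀ᶠ y in 𝓝 x, S.minimalUConnection (fun z ↦ S.J z (Z z)) y (V y) =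
        S.J y (S.minimalUConnection Z y (V y)) := by
      filter_upwards [eventually_mdifferentiableAt_section hZ] with y hy
      exact S.minimalUConnection_J hy _
    rw [connection_congr ((hs (S.contMDiffAt_J hZ) hV).mdifferentiableAt (by simp)) hJ,
      S.minimalUConnection_J ((hs hZ hV).mdifferentiableAt (by simp))]
  rw [curvatureOf, curvatureOf, second_derivative hX, second_derivative hY,
    S.minimalUConnection_J (hZ.mdifferentiableAt (by simp)), map_add, map_sub]

theorem curvatureAt_minimalUConnection_J (a b c : TangentSpace 𝓘(ℝ, E) x) :
    curvatureAt S.minimalUConnection x a b (S.J x c) =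
      S.J x (curvatureAt S.minimalUConnection x a b c) := by
  have hc := contMDiffAt_extend 𝓘(ℝ, E) E c (k := ∞)
  have h := curvatureAt_eq_curvatureOf S.isSmoothConnection_minimalUConnection
    S.isMetricConnection_minimalUConnection a b (S.contMDiffAt_J hc)
  rwa [extend_apply_self, S.curvatureOf_minimalUConnection_J (contMDiffAt_extend 𝓘(ℝ, E) E a)
    (contMDiffAt_extend 𝓘(ℝ, E) E b) hc] at h

end MinimalUConnection

section DerivativeOfTorsion

/-- The covariant derivative `(∇ᵁ_X ξ)_Y Z` of the intrinsic torsion on vector fields. -/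
def nablaXiField (X Y Z : Π x : M, TangentSpace 𝓘(ℝ, E) x) (x : M) : TangentSpace 𝓘(ℝ, E) x :=
  S.minimalUConnection (fun y ↦ S.xi y (Y y) (Z y)) x (X x)
    - S.xi x (S.minimalUConnection Y x (X x)) (Z x)
    - S.xi x (Y x) (S.minimalUConnection Z x (X x))

theorem nablaXi_eq_nablaXiField (a b c : TangentSpace 𝓘(ℝ, E) x) :
    S.nablaXi x a b c = S.nablaXiField (extend E a) (extend E b) (extend E c) x := by
  simp only [nablaXi, nablaXiField, extend_apply_self]

theorem inner_nablaXiField (hY : CMDiffAt ∞ (T% Y) x) (hZ : CMDiffAt ∞ (T% Z) x)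
    (hW : CMDiffAt ∞ (T% W) x) :
    ⟪S.nablaXiField X Y Z x, W x⟫ = -⟪Z x, S.nablaXiField X Y W x⟫ := by
  have hm := S.isMetricConnection_minimalUConnection
  have hleft := hm ((S.contMDiffAt_xi hY hZ).mdifferentiableAt (by simp))
    (hW.mdifferentiableAt (by simp)) (X x)
  have hright := hm (hZ.mdifferentiableAt (by simp))
    ((S.contMDiffAt_xi hY hW).mdifferentiableAt (by simp)) (X x)
  simp only [S.inner_xi _ _ (Z _) (W _)] at hleft
  rw [mvfderiv_fun_neg, neg_apply, hright, S.inner_xi x (Y x) (Z x)] at hleft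
  rw [nablaXiField, nablaXiField, inner_sub_left, inner_sub_left, inner_sub_right,
    inner_sub_right, S.inner_xi x (Y x), S.inner_xi x (S.minimalUConnection Y x (X x))]
  linarith

theorem nablaXiField_J (hY : CMDiffAt ∞ (T% Y) x) (hZ : CMDiffAt ∞ (T% Z) x) :
    S.nablaXiField X Y (fun y ↦ S.J y (Z y)) x = -S.J x (S.nablaXiField X Y Z x) := by
  have hxi := (S.contMDiffAt_xi hY hZ).mdifferentiableAt (by simp)
  simp only [nablaXiField, S.xi_J]
  rw [connection_neg (S.mdifferentiableAt_J hxi), neg_apply, S.minimalUConnection_J hxi,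
    S.minimalUConnection_J (hZ.mdifferentiableAt (by simp)), S.xi_J]
  simp only [map_sub]
  abel

theorem inner_nablaXi (x : M) (a b c d : TangentSpace 𝓘(ℝ, E) x) :
    ⟪S.nablaXi x a b c, d⟫ = -⟪c, S.nablaXi x a b d⟫ := by
  have h := S.inner_nablaXiField (X := extend E a) (contMDiffAt_extend 𝓘(ℝ, E) E b)
    (contMDiffAt_extend 𝓘(ℝ, E) E c) (contMDiffAt_extend 𝓘(ℝ, E) E d)
  rwa [← nablaXi_eq_nablaXiField, ← nablaXi_eq_nablaXiField, extend_apply_self,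
    extend_apply_self] at h

theorem nablaXi_J (x : M) (a b c : TangentSpace 𝓘(ℝ, E) x) :
    S.nablaXi x a b (S.J x c) = -S.J x (S.nablaXi x a b c) := by
  have hb := contMDiffAt_extend 𝓘(ℝ, E) E b (k := ∞)
  have hc := contMDiffAt_extend 𝓘(ℝ, E) E c (k := ∞)
  rw [nablaXi_eq_nablaXiField _ a b c, ← S.nablaXiField_J hb hc]
  refine ext_inner_right ℝ fun d ↦ ?_
  have h := S.inner_nablaXiField (X := extend E a) hb (S.contMDiffAt_J hc)
    (contMDiffAt_extend 𝓘(ℝ, E) E d)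
  rw [← nablaXi_eq_nablaXiField, extend_apply_self, extend_apply_self] at h
  rw [h, S.inner_nablaXi]

end DerivativeOfTorsion

section Curvature

theorem minimalUConnection_torsion (hX : MDiffAt (T% X) x) (hY : MDiffAt (T% Y) x) :
    mlieBracket 𝓘(ℝ, E) X Y x = S.minimalUConnection Y x (X x) - S.minimalUConnection X x (Y x)
      - S.xi x (X x) (Y x) + S.xi x (Y x) (X x) := by
  rw [← leviCivita_torsion hX hY, minimalUConnection_apply, minimalUConnection_apply]
  abel

theorem curvatureOf_leviCivita_eq (hX : CMDiffAt ∞ (T% X) x) (hY : CMDiffAt ∞ (T% Y) x)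
    (hZ : CMDiffAt ∞ (T% Z) x) :
    curvatureOf (leviCivita E M) X Y Z x =
      curvatureOf S.minimalUConnection X Y Z x + S.nablaXiField X Y Z x - S.nablaXiField Y X Z x
      + S.xi x (S.xi x (X x) (Y x)) (Z x) - S.xi x (S.xi x (Y x) (X x)) (Z x)
      - S.xi x (X x) (S.xi x (Y x) (Z x)) + S.xi x (Y x) (S.xi x (X x) (Z x)) := by
  rw [curvatureOf_eq_of_eq_add (A := S.torsion) (fun _ ↦ rfl)
    isSmoothConnection_leviCivita S.isSmoothConnection_minimalUConnection hX hY hZ,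
    S.minimalUConnection_torsion (hX.mdifferentiableAt (by simp)) (hY.mdifferentiableAt (by simp))]
  simp only [nablaXiField, xi, map_sub, map_add]
  abel

theorem curvature_eq (x : M) (a b c : TangentSpace 𝓘(ℝ, E) x) :
    curvature x a b c = curvatureAt S.minimalUConnection x a b c
      + S.nablaXi x a b c - S.nablaXi x b a c
      + S.xi x (S.xi x a b) c - S.xi x (S.xi x b a) c
      - S.xi x a (S.xi x b c) + S.xi x b (S.xi x a c) := by
  have h := S.curvatureOf_leviCivita_eq (contMDiffAt_extend 𝓘(ℝ, E) E a)
    (contMDiffAt_extend 𝓘(ℝ, E) E b) (contMDiffAt_extend 𝓘(ℝ, E) E c)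
  simp only [← nablaXi_eq_nablaXiField, extend_apply_self] at h
  exact h

variable {ι : Type*} [Fintype ι] (e : OrthonormalBasis ι ℝ (TangentSpace 𝓘(ℝ, E) x))

theorem inner_curvature_J (a b v : TangentSpace 𝓘(ℝ, E) x) :
    ⟪curvature x a b v, S.J x v⟫ =
      ⟪curvatureAt S.minimalUConnection x a b v, S.J x v⟫
        - 2 * ⟪S.xi x a v, S.xi x b (S.J x v)⟫ := by
  have vanish {A : TangentSpace 𝓘(ℝ, E) x → TangentSpace 𝓘(ℝ, E) x}
      (hA : ∀ c d, ⟪A c, d⟫ = -⟪c, A d⟫) (hAJ : ∀ c, A (S.J x c) = -S.J x (A c)) :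
      ⟪A v, S.J x v⟫ = 0 :=
    (S.isOrthogonalComplexStructure x).inner_map_eq_zero hA hAJ v
  have hab : ⟪S.xi x a (S.xi x b v), S.J x v⟫ = ⟪S.xi x a v, S.xi x b (S.J x v)⟫ := by
    rw [S.inner_xi, S.xi_J, S.xi_J, inner_neg_right, inner_neg_right, neg_neg, ← neg_eq_iff_eq_neg,
      ← S.inner_J_left, real_inner_comm]
  have hba : ⟪S.xi x b (S.xi x a v), S.J x v⟫ = -⟪S.xi x a v, S.xi x b (S.J x v)⟫ :=
    S.inner_xi ..
  rw [S.curvature_eq]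
  simp only [inner_add_left, inner_sub_left, vanish (S.inner_nablaXi x _ _) (S.nablaXi_J x _ _),
    vanish (S.inner_xi x _) (S.xi_J x _), hab, hba]
  ring

theorem sum_inner_curvature_J (a b : TangentSpace 𝓘(ℝ, E) x) :
    ∑ i, ⟪curvature x a b (e i), S.J x (e i)⟫ =
      ∑ i, ⟪curvatureAt S.minimalUConnection x a b (e i), S.J x (e i)⟫
        - 2 * ∑ i, ⟪S.xi x a (e i), S.xi x b (S.J x (e i))⟫ := by
  simp only [S.inner_curvature_J, Finset.sum_sub_distrib, Finset.mul_sum]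

theorem two_mul_ricciStar (a b : TangentSpace 𝓘(ℝ, E) x) :
    2 * S.ricciStar e a b = ∑ i, ⟪curvature x a (S.J x b) (e i), S.J x (e i)⟫ := by
  have bianchi (i : ι) : ⟪curvature x a (S.J x b) (e i), S.J x (e i)⟫ =
      ⟪curvature x a (e i) (S.J x b), S.J x (e i)⟫
        - ⟪curvature x a (S.J x (e i)) (S.J x b), e i⟫ := by
    have h := congrArg (fun v ↦ ⟪v, S.J x (e i)⟫) (curvature_bianchi a (S.J x b) (e i))
    simp only [inner_add_left, inner_zero_left] at h
    rw [curvature_swap a (e i), inner_neg_left,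
      inner_curvature_pair_symm (S.J x b) (e i) a] at h
    linarith
  have hJ : ∑ i, ⟪curvature x a (S.J x (e i)) (S.J x b), e i⟫ = -S.ricciStar e a b :=
    (S.isOrthogonalComplexStructure x).sum_inner_map_J e (curvatureMid a (S.J x b))
  rw [Finset.sum_congr rfl fun i _ ↦ bianchi i, Finset.sum_sub_distrib, hJ, ricciStar]
  ring

theorem ricci_eq_ricciStar_add (a b : TangentSpace 𝓘(ℝ, E) x) :
    ricci e a b = S.ricciStar e a b
        - 2 * ∑ i, ⟪S.nablaXi x (e i) a b, e i⟫ + 2 * ∑ i, ⟪S.nablaXi x a (e i) b, e i⟫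
        - 2 * ∑ i, ⟪S.xi x (S.xi x (e i) a) b, e i⟫
        + 2 * ∑ i, ⟪S.xi x (S.xi x a (e i)) b, e i⟫ := by
  simp only [ricci, ricciStar, Finset.mul_sum, ← Finset.sum_sub_distrib, ← Finset.sum_add_distrib]
  refine Finset.sum_congr rfl fun i _ ↦ ?_
  rw [S.curvature_eq x a (e i) b, S.curvature_eq x a (e i) (S.J x b)]
  simp only [inner_add_left, inner_sub_left, S.curvatureAt_minimalUConnection_J, S.nablaXi_J,
    S.xi_J, S.xi_neg_right, S.inner_J_J, neg_neg, inner_neg_left]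
  ring

end Curvature

end AlmostHermitian

section ParallelTensors

theorem mvfderiv_fun_sum {ι : Type*} {s : Finset ι} {f : ι → M → F} {x : M}
    (hf : ∀ i ∈ s, MDiffAt (f i) x) (v : TangentSpace 𝓘(ℝ, E) x) :
    d% (fun y ↦ ∑ i ∈ s, f i y) x v = ∑ i ∈ s, d% (f i) x v := by
  classical
  suffices h : MDiffAt (fun y ↦ ∑ i ∈ s, f i y) x ∧
      d% (fun y ↦ ∑ i ∈ s, f i y) x v = ∑ i ∈ s, d% (f i) x v from h.2
  induction s using Finset.induction_on with
  | empty => simp [mvfderiv_const, mdifferentiableAt_const]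
  | insert i s hi ih =>
    rw [Finset.forall_mem_insert] at hf
    obtain ⟨hsum, hderiv⟩ := ih hf.2
    simp only [Finset.sum_insert hi]
    exact ⟨hf.1.add hsum, by rw [mvfderiv_fun_add hf.1 hsum, add_apply, hderiv]⟩

variable {ι : Type*}

theorem update_vectorField_apply [DecidableEq ι] (U : ι → Π x : M, TangentSpace 𝓘(ℝ, E) x) (i : ι)
    (X : Π x : M, TangentSpace 𝓘(ℝ, E) x) (y : M) :
    (fun k ↦ Function.update U i X k y) = Function.update (fun k ↦ U k y) i (X y) :=
  funext fun k ↦ Function.apply_update (fun _ (V : Π x : M, TangentSpace 𝓘(ℝ, E) x) ↦ V y) U i X k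

variable [IsManifold 𝓘(ℝ, E) ∞ M]

/-- The covariant tensor field `φ` is smooth: it takes smooth vector fields to smooth functions. -/
def IsSmoothTensor
    (φ : Π x : M, ContinuousMultilinearMap ℝ (fun _ : ι ↦ TangentSpace 𝓘(ℝ, E) x) F) : Prop :=
  ∀ (x : M) (U : ι → Π x : M, TangentSpace 𝓘(ℝ, E) x), (∀ i, CMDiffAt ∞ (T% (U i)) x) →
    ContMDiffAt 𝓘(ℝ, E) 𝓘(ℝ, F) ∞ (fun y ↦ φ y fun i ↦ U i y) x

variable [DecidableEq ι]
  {φ : Π x : M, ContinuousMultilinearMap ℝ (fun _ : ι ↦ TangentSpace 𝓘(ℝ, E) x) F}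
  {U : ι → Π x : M, TangentSpace 𝓘(ℝ, E) x} {X Y : Π x : M, TangentSpace 𝓘(ℝ, E) x} {x : M}

theorem IsSmoothTensor.contMDiffAt_update (hφ : IsSmoothTensor φ)
    (hU : ∀ i, CMDiffAt ∞ (T% (U i)) x) (hX : CMDiffAt ∞ (T% X) x) (i : ι) :
    ContMDiffAt 𝓘(ℝ, E) 𝓘(ℝ, F) ∞
      (fun y ↦ φ y (Function.update (fun k ↦ U k y) i (X y))) x := by
  have h := hφ x (Function.update U i X) fun k ↦ by
    obtain rfl | hk := eq_or_ne k i
    · rwa [Function.update_self]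
    · rw [Function.update_of_ne hk]
      exact hU k
  simpa only [update_vectorField_apply] using h

variable [Fintype ι]

/-- The covariant tensor field `φ` is parallel for the connection `D`. -/
def IsParallelTensor (D : Connection E M)
    (φ : Π x : M, ContinuousMultilinearMap ℝ (fun _ : ι ↦ TangentSpace 𝓘(ℝ, E) x) F) : Prop :=
  ∀ (x : M) (U : ι → Π x : M, TangentSpace 𝓘(ℝ, E) x), (∀ i, MDiffAt (T% (U i)) x) →
    ∀ v : TangentSpace 𝓘(ℝ, E) x, d% (fun y ↦ φ y fun i ↦ U i y) x v =
      ∑ i, φ x (Function.update (fun j ↦ U j x) i (D (U i) x v))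

variable {D : Connection E M}

theorem IsParallelTensor.mvfderiv_update (hpar : IsParallelTensor D φ)
    (hU : ∀ i, MDiffAt (T% (U i)) x) (hX : MDiffAt (T% X) x) (i : ι)
    (v : TangentSpace 𝓘(ℝ, E) x) :
    d% (fun y ↦ φ y (Function.update (fun k ↦ U k y) i (X y))) x v =
      φ x (Function.update (fun k ↦ U k x) i (D X x v)) + ∑ j ∈ Finset.univ.erase i,
        φ x (Function.update (Function.update (fun k ↦ U k x) i (X x)) j (D (U j) x v)) := by
  have h := hpar x (Function.update U i X) (fun k ↦ by
    obtain rfl | hk := eq_or_ne k i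
    · rwa [Function.update_self]
    · rw [Function.update_of_ne hk]
      exact hU k) v
  simp only [update_vectorField_apply] at h
  rw [h, ← Finset.add_sum_erase _ _ (Finset.mem_univ i), Function.update_self,
    Function.update_idem]
  refine congrArg _ (Finset.sum_congr rfl fun j hj ↦ ?_)
  rw [Function.update_of_ne (Finset.ne_of_mem_erase hj)]

theorem IsParallelTensor.mvfderiv_mvfderiv (hpar : IsParallelTensor D φ) (hφ : IsSmoothTensor φ)
    (hD : IsSmoothConnection D) (hU : ∀ i, CMDiffAt ∞ (T% (U i)) x)
    (hY : CMDiffAt ∞ (T% Y) x) (v : TangentSpace 𝓘(ℝ, E) x) :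
    d% (fun y ↦ d% (fun z ↦ φ z fun i ↦ U i z) y (Y y)) x v =
      ∑ i, φ x (Function.update (fun k ↦ U k x) i (D (fun y ↦ D (U i) y (Y y)) x v)) +
      ∑ i, ∑ j ∈ Finset.univ.erase i,
        φ x (Function.update (Function.update (fun k ↦ U k x) i (D (U i) x (Y x))) j
          (D (U j) x v)) := by
  have first_derivative : ∀ᶠ y in 𝓝 x, d% (fun z ↦ φ z fun i ↦ U i z) y (Y y) =
      ∑ i, φ y (Function.update (fun k ↦ U k y) i (D (U i) y (Y y))) := by
    filter_upwards [eventually_all.2 fun i ↦ eventually_mdifferentiableAt_section (hU i)] with y hy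
    exact hpar y U hy _
  rw [mvfderiv_apply_congr first_derivative, mvfderiv_fun_sum fun i _ ↦
    (hφ.contMDiffAt_update hU (hD (hU i) hY) i).mdifferentiableAt (by simp),
    ← Finset.sum_add_distrib]
  exact Finset.sum_congr rfl fun i _ ↦ hpar.mvfderiv_update
    (fun k ↦ (hU k).mdifferentiableAt (by simp)) ((hD (hU i) hY).mdifferentiableAt (by simp)) i v

theorem IsParallelTensor.sum_update_curvatureOf [CompleteSpace E] (hpar : IsParallelTensor D φ)
    (hφ : IsSmoothTensor φ) (hD : IsSmoothConnection D) (hX : CMDiffAt ∞ (T% X) x)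
    (hY : CMDiffAt ∞ (T% Y) x) (hU : ∀ i, CMDiffAt ∞ (T% (U i)) x) :
    ∑ i, φ x (Function.update (fun k ↦ U k x) i (curvatureOf D X Y (U i) x)) = 0 := by
  have h := mvfderiv_mlieBracket (hφ x U hU) hX hY
  rw [hpar.mvfderiv_mvfderiv hφ hD hU hY, hpar.mvfderiv_mvfderiv hφ hD hU hX,
    hpar x U fun i ↦ (hU i).mdifferentiableAt (by simp)] at h
  have mixed_symm : ∑ i, ∑ j ∈ Finset.univ.erase i,
        φ x (Function.update (Function.update (fun k ↦ U k x) i (D (U i) x (Y x))) j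
          (D (U j) x (X x))) = ∑ i, ∑ j ∈ Finset.univ.erase i,
        φ x (Function.update (Function.update (fun k ↦ U k x) i (D (U i) x (X x))) j
          (D (U j) x (Y x))) := by
    rw [Finset.sum_comm' (t' := Finset.univ) (s' := fun j ↦ Finset.univ.erase j)
      (by simp [eq_comm])]
    refine Finset.sum_congr rfl fun j _ ↦ Finset.sum_congr rfl fun i hi ↦ ?_
    rw [Function.update_comm (Finset.ne_of_mem_erase hi)]
  rw [mixed_symm, add_sub_add_right_eq_sub] at h
  simp only [curvatureOf, ContinuousMultilinearMap.map_update_add,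
    ContinuousMultilinearMap.map_update_sub, Finset.sum_add_distrib, Finset.sum_sub_distrib, h]
  abel

end ParallelTensors

theorem alternatingMap_comp_eq_zero {R V N ι : Type*} [Ring R] [AddCommGroup V] [Module R V]
    [AddCommGroup N] [Module R N] [Finite ι] {φ : V [⋀^ι]→ₗ[R] N} {u : ι → V}
    (hu : φ u = 0) (k : ι → ι) : φ (u ∘ k) = 0 := by
  classical
  have := Fintype.ofFinite ι
  by_cases hk : Function.Injective k
  · have h := φ.map_perm u (Equiv.ofBijective k (Finite.injective_iff_bijective.1 hk))
    rwa [hu, smul_zero] at h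
  · obtain ⟨i, j, hij, hne⟩ := Function.not_injective_iff.1 hk
    exact φ.map_eq_zero_of_eq _ (congrArg u hij) hne

/-! ### The minimal `SU(n)`-connection -/

namespace SpecialStructure

variable [IsManifold 𝓘(ℝ, E) ∞ M] [RiemannianBundle (fun x : M ↦ TangentSpace 𝓘(ℝ, E) x)]
  {n : ℕ} (S : SpecialStructure E M n) {D : Connection E M}
  {X Y Z : Π x : M, TangentSpace 𝓘(ℝ, E) x} {x : M}

section VolumeForm

theorem Ψ_ne_zero {u : Fin n → TangentSpace 𝓘(ℝ, E) x}
    (hu : IsUnitary (S.J x).toLinearMap u) : S.Ψ x u ≠ 0 := by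
  intro h0
  have norm_eq_one := S.norm_Ψ x u fun i j ↦ by
    have h : ⟪u i, S.J x (u j)⟫ = (0 : ℝ) := hu.inner_map i j
    rw [AlmostHermitian.hermitian, orthonormal_iff_ite.1 hu.orthonormal, h]
    split_ifs <;> simp
  have comp_eq_zero (k : Fin n → Fin n) : S.Ψ x (fun i ↦ u (k i)) = 0 :=
    alternatingMap_comp_eq_zero (φ := (S.Ψ x).toAlternatingMap) h0 k
  simp [comp_eq_zero] at norm_eq_one

theorem Ψ_update_smul_J (u : Fin n → TangentSpace 𝓘(ℝ, E) x) (i : Fin n) (c : ℝ) :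
    S.Ψ x (Function.update u i (c • S.J x (u i))) = c * Complex.I * S.Ψ x u := by
  rw [ContinuousAlternatingMap.map_update_smul, S.Ψ_J, Complex.real_smul, mul_assoc]

theorem isSmoothTensor_Ψ : IsSmoothTensor fun x ↦ (S.Ψ x).toContinuousMultilinearMap :=
  S.smooth_Ψ

end VolumeForm

variable [FiniteDimensional ℝ E]
  [IsContMDiffRiemannianBundle 𝓘(ℝ, E) ∞ E (fun x : M ↦ TangentSpace 𝓘(ℝ, E) x)]

section IntrinsicTorsion

theorem connection_eq_add_eta (hY : MDiffAt (T% Y) x) (v : TangentSpace 𝓘(ℝ, E) x) :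
    D Y x v = S.minimalUConnection Y x v + S.eta D x v (Y x) := by
  have difference_apply : connectionDifference D x v (Y x) = D Y x v - leviCivita E M Y x v :=
    congrArg (fun A ↦ A v) (IsCovariantDerivativeOn.difference_apply
      D.isCovariantDerivativeOnUniv (leviCivita E M).isCovariantDerivativeOnUniv (mem_univ x) hY)
  change _ = _ + (connectionDifference D x v (Y x) - S.xi x v (Y x))
  rw [difference_apply, S.minimalUConnection_apply]
  abel

theorem trace_J_comp_eta_sub (hn : n ≠ 0) (hE : Module.finrank ℝ E = 2 * n) (x : M)
    (u : TangentSpace 𝓘(ℝ, E) x) :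
    LinearMap.trace ℝ (TangentSpace 𝓘(ℝ, E) x)
      (S.J x ∘L (S.eta D x u - S.etaHat D x u • S.J x)).toLinearMap = 0 := by
  have comp_eq : (S.J x ∘L (S.eta D x u - S.etaHat D x u • S.J x)).toLinearMap =
      (S.J x ∘L S.eta D x u).toLinearMap + S.etaHat D x u • LinearMap.id := by
    ext w
    change S.J x (S.eta D x u w - S.etaHat D x u • S.J x w) =
      S.J x (S.eta D x u w) + S.etaHat D x u • w
    rw [map_sub, map_smul, S.J_J, smul_neg, sub_neg_eq_add]
  have hdim : Module.finrank ℝ (TangentSpace 𝓘(ℝ, E) x) = 2 * n := hE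
  rw [comp_eq, map_add, map_smul, LinearMap.trace_id, hdim, etaHat, smul_eq_mul]
  push_cast
  field_simp
  ring

namespace IsMinimalSUConnection

variable {S} (hD : S.IsMinimalSUConnection D)
include hD

theorem inner_eta (x : M) (u v w : TangentSpace 𝓘(ℝ, E) x) :
    ⟪S.eta D x u v, w⟫ = -⟪v, S.eta D x u w⟫ := by
  change ⟪connectionDifference D x u v - S.xi x u v, w⟫ =
    -⟪v, connectionDifference D x u w - S.xi x u w⟫
  rw [inner_sub_left, inner_sub_right, (hD.mem_suPerp x u).1, S.inner_xi]
  ring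

theorem eta_J (x : M) (u v : TangentSpace 𝓘(ℝ, E) x) :
    S.eta D x u (S.J x v) = S.J x (S.eta D x u v) := by
  have hV : CMDiffAt ∞ (T% (extend E v)) x := contMDiffAt_extend 𝓘(ℝ, E) E v
  have hdiff := hV.mdifferentiableAt (by simp)
  have h := hD.parallel_J x _ hdiff u
  rw [S.connection_eq_add_eta ((S.contMDiffAt_J hV).mdifferentiableAt (by simp)),
    S.connection_eq_add_eta hdiff, S.minimalUConnection_J hdiff, map_add, extend_apply_self] at h
  exact add_left_cancel h

theorem eta_sub_mem_suAlgebra (hn : n ≠ 0) (hE : Module.finrank ℝ E = 2 * n) (x : M)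
    (u : TangentSpace 𝓘(ℝ, E) x) :
    S.eta D x u - S.etaHat D x u • S.J x ∈ S.suAlgebra x := by
  have skew (v w : TangentSpace 𝓘(ℝ, E) x) :
      ⟪(S.eta D x u - S.etaHat D x u • S.J x) v, w⟫ =
        -⟪v, (S.eta D x u - S.etaHat D x u • S.J x) w⟫ := by
    rw [sub_apply, sub_apply, smul_apply, smul_apply, inner_sub_left, inner_sub_right,
      hD.inner_eta, real_inner_smul_left, real_inner_smul_right, S.inner_J_left]
    ring
  refine ⟨skew, fun v ↦ ?_, trace_eq_zero_of_skew skew, S.trace_J_comp_eta_sub hn hE x u⟩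
  rw [sub_apply, sub_apply, smul_apply, smul_apply, hD.eta_J, map_sub, map_smul]

theorem eta_eq (hn : n ≠ 0) (hE : Module.finrank ℝ E = 2 * n) (x : M)
    (u v : TangentSpace 𝓘(ℝ, E) x) : S.eta D x u v = S.etaHat D x u • S.J x v := by
  set B := S.eta D x u - S.etaHat D x u • S.J x
  obtain ⟨skew, comm, -, trace_J⟩ := hD.eta_sub_mem_suAlgebra hn hE x u
  let ξ : TangentSpace 𝓘(ℝ, E) x →L[ℝ] TangentSpace 𝓘(ℝ, E) x :=
    ContinuousLinearMap.apply ℝ (TangentSpace 𝓘(ℝ, E) x) u ∘L S.torsion x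
  have trace_difference := (hD.mem_suPerp x u).2 B (hD.eta_sub_mem_suAlgebra hn hE x u)
  have trace_xi : LinearMap.trace ℝ (TangentSpace 𝓘(ℝ, E) x) (ξ ∘L B).toLinearMap = 0 := by
    refine trace_eq_zero_of_anticommute (J := (S.J x).toLinearMap)
      (LinearMap.ext (S.J_J x)) (LinearMap.ext fun w ↦ ?_)
    change S.xi x u (B (S.J x w)) = -S.J x (S.xi x u (B w))
    rw [comm, S.xi_J]
  have trace_sq :
      LinearMap.trace ℝ (TangentSpace 𝓘(ℝ, E) x) (B.toLinearMap ∘ₗ B.toLinearMap) = 0 := by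
    have decomposition : B.toLinearMap ∘ₗ B.toLinearMap =
        (connectionDifference D x u ∘L B).toLinearMap - (ξ ∘L B).toLinearMap
          - S.etaHat D x u • (S.J x ∘L B).toLinearMap := rfl
    rw [decomposition, map_sub, map_sub, map_smul, trace_difference, trace_xi, trace_J,
      smul_zero, sub_zero, sub_zero]
  exact sub_eq_zero.1 (congrArg (fun A ↦ A v) (eq_zero_of_skew_of_trace_sq_eq_zero skew trace_sq))

theorem connection_eq (hn : n ≠ 0) (hE : Module.finrank ℝ E = 2 * n) (hZ : MDiffAt (T% Z) x)
    (v : TangentSpace 𝓘(ℝ, E) x) :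
    D Z x v = S.minimalUConnection Z x v + S.etaHat D x v • S.J x (Z x) := by
  rw [S.connection_eq_add_eta hZ, hD.eta_eq hn hE]

end IsMinimalSUConnection

end IntrinsicTorsion

namespace IsMinimalSUConnection

variable {S} (hD : S.IsMinimalSUConnection D) (hn : n ≠ 0) (hE : Module.finrank ℝ E = 2 * n)
include hD hn hE

theorem mvfderiv_Ψ {U : Fin n → Π x : M, TangentSpace 𝓘(ℝ, E) x}
    (hU : ∀ i, MDiffAt (T% (U i)) x) (v : TangentSpace 𝓘(ℝ, E) x) :
    d% (fun y ↦ S.Ψ y fun i ↦ U i y) x v =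
      ∑ i, S.Ψ x (Function.update (fun k ↦ U k x) i (S.minimalUConnection (U i) x v)) +
        n * (S.etaHat D x v * Complex.I * S.Ψ x fun i ↦ U i x) := by
  have update_eq (i : Fin n) : S.Ψ x (Function.update (fun k ↦ U k x) i (D (U i) x v)) =
      S.Ψ x (Function.update (fun k ↦ U k x) i (S.minimalUConnection (U i) x v)) +
        S.etaHat D x v * Complex.I * S.Ψ x fun i ↦ U i x := by
    rw [hD.connection_eq hn hE (hU i), ContinuousAlternatingMap.map_update_add,
      S.Ψ_update_smul_J (fun k ↦ U k x)]
  rw [hD.parallel_Ψ x U hU v]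
  simp only [update_eq, Finset.sum_add_distrib, Finset.sum_const, Finset.card_univ,
    Fintype.card_fin, nsmul_eq_mul]

theorem contMDiffAt_etaHat (hX : CMDiffAt ∞ (T% X) x) :
    ContMDiffAt 𝓘(ℝ, E) 𝓘(ℝ, ℝ) ∞ (fun y ↦ S.etaHat D y (X y)) x := by
  obtain ⟨u, hu⟩ := (S.isOrthogonalComplexStructure x).exists_isUnitary n hE.ge
  let U (i : Fin n) : Π x : M, TangentSpace 𝓘(ℝ, E) x := extend E (u i)
  have hU (i : Fin n) : CMDiffAt ∞ (T% (U i)) x := contMDiffAt_extend 𝓘(ℝ, E) E (u i)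
  let f (y : M) : ℂ := S.Ψ y fun i ↦ U i y
  have hf : ContMDiffAt 𝓘(ℝ, E) 𝓘(ℝ, ℂ) ∞ f x := S.smooth_Ψ x U hU
  have f_ne_zero : f x ≠ 0 := by simpa only [f, U, extend_apply_self] using S.Ψ_ne_zero hu
  have hn' : (n : ℂ) * Complex.I ≠ 0 := mul_ne_zero (Nat.cast_ne_zero.2 hn) Complex.I_ne_zero
  let g (y : M) : ℂ := d% f y (X y) -
    ∑ i, S.Ψ y (Function.update (fun k ↦ U k y) i (S.minimalUConnection (U i) y (X y)))
  have hg : ContMDiffAt 𝓘(ℝ, E) 𝓘(ℝ, ℂ) ∞ g x :=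
    (contMDiffAt_mvfderiv_apply hf hX).sub (contMDiffAt_finsetSum fun i _ ↦
      S.isSmoothTensor_Ψ.contMDiffAt_update hU
        (S.isSmoothConnection_minimalUConnection (hU i) hX) i)
  have quotient_smooth : ContDiffAt ℝ ∞
      (fun p : ℂ × ℂ ↦ Complex.reCLM (p.1 * (n * Complex.I * p.2)⁻¹)) (g x, f x) :=
    Complex.reCLM.contDiff.contDiffAt.comp _ (contDiffAt_fst.mul
      ((contDiffAt_const.mul contDiffAt_snd).inv (mul_ne_zero hn' f_ne_zero)))
  refine (quotient_smooth.contMDiffAt.comp x (hg.prodMk_space hf)).congr_of_eventuallyEq ?_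
  filter_upwards [eventually_all.2 fun i ↦ eventually_mdifferentiableAt_section (hU i),
    hf.continuousAt.eventually_ne f_ne_zero] with y hUy hfy
  have g_eq : g y = S.etaHat D y (X y) * (n * Complex.I * f y) := by
    simp only [g, f, hD.mvfderiv_Ψ hn hE hUy, add_sub_cancel_left]
    ring
  simp only [Function.comp_apply, g_eq, mul_inv_cancel_right₀ (mul_ne_zero hn' hfy),
    Complex.reCLM_apply, Complex.ofReal_re]

theorem isSmoothConnection : IsSmoothConnection D := by
  intro Z X x hZ hX
  refine ((S.isSmoothConnection_minimalUConnection hZ hX).add_section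
    ((hD.contMDiffAt_etaHat hn hE hX).smul_section (S.contMDiffAt_J hZ))).congr_of_eventuallyEq ?_
  filter_upwards [eventually_mdifferentiableAt_section hZ] with y hy
  exact congrArg (TotalSpace.mk y) (hD.connection_eq hn hE hy _)

theorem curvatureOf_minimalUConnection (hX : CMDiffAt ∞ (T% X) x) (hY : CMDiffAt ∞ (T% Y) x)
    (hZ : CMDiffAt ∞ (T% Z) x) :
    curvatureOf S.minimalUConnection X Y Z x = curvatureOf D X Y Z x
      + (d% (fun y ↦ S.etaHat D y (Y y)) x (X x) - d% (fun y ↦ S.etaHat D y (X y)) x (Y x)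
          - S.etaHat D x (mlieBracket 𝓘(ℝ, E) X Y x)) • S.J x (Z x) := by
  have hJZ := (S.contMDiffAt_J hZ).mdifferentiableAt (by simp)
  have curvature_change := curvatureOf_eq_of_eq_add
    (A := fun x ↦ D.difference (leviCivita E M) x - S.torsion x)
    (fun hZ ↦ ContinuousLinearMap.ext fun v ↦ S.connection_eq_add_eta hZ v)
    S.isSmoothConnection_minimalUConnection (hD.isSmoothConnection hn hE) hX hY hZ
  have difference_eq (x : M) (w v : TangentSpace 𝓘(ℝ, E) x) :
      (D.difference (leviCivita E M) x - S.torsion x) w v = S.etaHat D x v • S.J x w :=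
    hD.eta_eq hn hE x v w
  have derivative_eq {V W : Π x : M, TangentSpace 𝓘(ℝ, E) x} (hW : CMDiffAt ∞ (T% W) x) :
      D (fun y ↦ S.etaHat D y (W y) • S.J y (Z y)) x (V x) =
        S.etaHat D x (W x) • S.J x (D Z x (V x)) +
          d% (fun y ↦ S.etaHat D y (W y)) x (V x) • S.J x (Z x) := by
    rw [connection_smul ((hD.contMDiffAt_etaHat hn hE hW).mdifferentiableAt (by simp)) hJZ,
      add_apply, smul_apply, hD.parallel_J x Z (hZ.mdifferentiableAt (by simp))]
    rfl
  rw [curvature_change]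
  simp only [difference_eq, derivative_eq hX, derivative_eq hY, map_smul, smul_apply]
  module

theorem sum_Ψ_update_curvatureAt (u : Fin n → TangentSpace 𝓘(ℝ, E) x)
    (a b : TangentSpace 𝓘(ℝ, E) x) :
    ∑ i, S.Ψ x (Function.update u i (curvatureAt S.minimalUConnection x a b (u i))) =
      n * (extDerivOneForm (S.etaHat D) x a b * Complex.I * S.Ψ x u) := by
  have hsmooth (v : TangentSpace 𝓘(ℝ, E) x) : CMDiffAt ∞ (T% (extend E v)) x :=
    contMDiffAt_extend 𝓘(ℝ, E) E v
  have sum_eq_zero := IsParallelTensor.sum_update_curvatureOf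
    (φ := fun x ↦ (S.Ψ x).toContinuousMultilinearMap) hD.parallel_Ψ S.isSmoothTensor_Ψ
    (hD.isSmoothConnection hn hE) (hsmooth a) (hsmooth b) fun i ↦ hsmooth (u i)
  have curvature_eq (i : Fin n) : curvatureAt S.minimalUConnection x a b (u i) =
      curvatureOf D (extend E a) (extend E b) (extend E (u i)) x +
        extDerivOneForm (S.etaHat D) x a b • S.J x (u i) := by
    have h := hD.curvatureOf_minimalUConnection hn hE (hsmooth a) (hsmooth b) (hsmooth (u i))
    simp only [extend_apply_self] at h
    exact h
  simp only [extend_apply_self] at sum_eq_zero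
  simp only [curvature_eq, ContinuousAlternatingMap.map_update_add, S.Ψ_update_smul_J,
    Finset.sum_add_distrib, Finset.sum_const, Finset.card_univ, Fintype.card_fin, nsmul_eq_mul]
  exact add_eq_right.2 sum_eq_zero

theorem sum_inner_curvatureAt {ι : Type*} [Fintype ι]
    (e : OrthonormalBasis ι ℝ (TangentSpace 𝓘(ℝ, E) x)) (a b : TangentSpace 𝓘(ℝ, E) x) :
    ∑ i, ⟪curvatureAt S.minimalUConnection x a b (e i), S.J x (e i)⟫ =
      2 * (n * extDerivOneForm (S.etaHat D) x a b) := by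
  have hJ := S.isOrthogonalComplexStructure x
  obtain ⟨u, hu⟩ := hJ.exists_isUnitary n hE.ge
  let R := curvatureHom S.isSmoothConnection_minimalUConnection
    S.isMetricConnection_minimalUConnection a b
  have hdim : Module.finrank ℝ (TangentSpace 𝓘(ℝ, E) x) = 2 * Fintype.card (Fin n) := by
    rw [Fintype.card_fin]
    exact hE
  have complexTrace_mul : complexTrace (S.J x).toLinearMap R * S.Ψ x u =
      n * (extDerivOneForm (S.etaHat D) x a b * Complex.I * S.Ψ x u) :=
    (hJ.sum_map_update_eq_complexTrace_mul (φ := (S.Ψ x).toAlternatingMap) hu hdim (S.Ψ_J x)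
      (S.curvatureAt_minimalUConnection_J a b)).symm.trans
      (hD.sum_Ψ_update_curvatureAt hn hE u a b)
  have complexTrace_eq : complexTrace (S.J x).toLinearMap R =
      n * (extDerivOneForm (S.etaHat D) x a b * Complex.I) :=
    mul_right_cancel₀ (S.Ψ_ne_zero hu) (by rw [complexTrace_mul]; ring)
  have trace_J : LinearMap.trace ℝ (TangentSpace 𝓘(ℝ, E) x) ((S.J x).toLinearMap ∘ₗ R) =
      -(2 * (n * extDerivOneForm (S.etaHat D) x a b)) := by
    have h := congrArg Complex.im complexTrace_eq
    rw [complexTrace_im, ← Complex.ofReal_natCast, Complex.im_ofReal_mul, Complex.im_ofReal_mul,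
      Complex.I_im, mul_one] at h
    linarith
  change ∑ i, ⟪R (e i), (S.J x).toLinearMap (e i)⟫ = _
  rw [hJ.sum_inner_eq_trace e R, trace_J, neg_neg]

theorem ricciStar_eq {ι : Type*} [Fintype ι]
    (e : OrthonormalBasis ι ℝ (TangentSpace 𝓘(ℝ, E) x)) (a b : TangentSpace 𝓘(ℝ, E) x) :
    S.ricciStar e a b = n * extDerivOneForm (S.etaHat D) x a (S.J x b)
      - ∑ i, ⟪S.xi x a (e i), S.xi x (S.J x b) (S.J x (e i))⟫ := by
  have h := S.two_mul_ricciStar e a b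
  rw [S.sum_inner_curvature_J, hD.sum_inner_curvatureAt hn hE] at h
  linarith

end IsMinimalSUConnection

end SpecialStructure

end SpecialAlmostHermitian

end

theorem lemma3p3_general {E : Type*} [NormedAddCommGroup E] [NormedSpace ℝ E]
    [FiniteDimensional ℝ E] {M : Type*} [TopologicalSpace M] [ChartedSpace E M]
    [IsManifold 𝓘(ℝ, E) ∞ M] [RiemannianBundle (fun x : M ↦ TangentSpace 𝓘(ℝ, E) x)]
    [IsContMDiffRiemannianBundle 𝓘(ℝ, E) ∞ E (fun x : M ↦ TangentSpace 𝓘(ℝ, E) x)]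
    {n : ℕ} (hn : n ≠ 0) (hE : Module.finrank ℝ E = 2 * n)
    {S : SpecialAlmostHermitian.SpecialStructure E M n}
    {D : CovariantDerivative 𝓘(ℝ, E) E (fun x : M ↦ TangentSpace 𝓘(ℝ, E) x)}
    (hD : S.IsMinimalSUConnection D) {x : M} {ι : Type*} [Fintype ι]
    (e : OrthonormalBasis ι ℝ (TangentSpace 𝓘(ℝ, E) x)) (X Y : TangentSpace 𝓘(ℝ, E) x) :
    S.eta D x X Y = S.etaHat D x X • S.J x Y ∧
    S.ricciStar e X Y =
      n * SpecialAlmostHermitian.extDerivOneForm (S.etaHat D) x X (S.J x Y)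
        - ∑ i, inner ℝ (S.xi x X (e i)) (S.xi x (S.J x Y) (S.J x (e i))) ∧
    SpecialAlmostHermitian.ricci e X Y =
      n * SpecialAlmostHermitian.extDerivOneForm (S.etaHat D) x X (S.J x Y)
        - ∑ i, inner ℝ (S.xi x X (e i)) (S.xi x (S.J x Y) (S.J x (e i)))
        - 2 * ∑ i, inner ℝ (S.nablaXi x (e i) X Y) (e i)
        + 2 * ∑ i, inner ℝ (S.nablaXi x X (e i) Y) (e i)
        - 2 * ∑ i, inner ℝ (S.xi x (S.xi x (e i) X) Y) (e i)
        + 2 * ∑ i, inner ℝ (S.xi x (S.xi x X (e i)) Y) (e i) := by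
  refine ⟨hD.eta_eq hn hE x X Y, hD.ricciStar_eq hn hE e X Y, ?_⟩
  rw [S.ricci_eq_ricciStar_add, hD.ricciStar_eq hn hE]

theorem lemma3p3 (n : ℕ) (hn : 2 ≤ n)
    (M : Type*) [TopologicalSpace M] [ChartedSpace (EuclideanSpace ℝ (Fin (2 * n))) M]
    [IsManifold 𝓘(ℝ, EuclideanSpace ℝ (Fin (2 * n))) ∞ M]
    [RiemannianBundle
      (fun x : M ↦ TangentSpace 𝓘(ℝ, EuclideanSpace ℝ (Fin (2 * n))) x)]
    [IsContMDiffRiemannianBundle 𝓘(ℝ, EuclideanSpace ℝ (Fin (2 * n))) ∞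
      (EuclideanSpace ℝ (Fin (2 * n)))
      (fun x : M ↦ TangentSpace 𝓘(ℝ, EuclideanSpace ℝ (Fin (2 * n))) x)]
    (S : SpecialAlmostHermitian.SpecialStructure (EuclideanSpace ℝ (Fin (2 * n))) M n)
    (D : CovariantDerivative 𝓘(ℝ, EuclideanSpace ℝ (Fin (2 * n)))
      (EuclideanSpace ℝ (Fin (2 * n)))
      (fun x : M ↦ TangentSpace 𝓘(ℝ, EuclideanSpace ℝ (Fin (2 * n))) x))
    (hD : S.IsMinimalSUConnection D) (x : M)
    (e : OrthonormalBasis (Fin (2 * n)) ℝ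
      (TangentSpace 𝓘(ℝ, EuclideanSpace ℝ (Fin (2 * n))) x))
    (X Y : TangentSpace 𝓘(ℝ, EuclideanSpace ℝ (Fin (2 * n))) x) :
    S.eta D x X Y = S.etaHat D x X • S.J x Y ∧
    S.ricciStar e X Y =
      n * SpecialAlmostHermitian.extDerivOneForm (S.etaHat D) x X (S.J x Y)
        - ∑ i, inner ℝ (S.xi x X (e i)) (S.xi x (S.J x Y) (S.J x (e i))) ∧
    SpecialAlmostHermitian.ricci e X Y =
      n * SpecialAlmostHermitian.extDerivOneForm (S.etaHat D) x X (S.J x Y)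
        - ∑ i, inner ℝ (S.xi x X (e i)) (S.xi x (S.J x Y) (S.J x (e i)))
        - 2 * ∑ i, inner ℝ (S.nablaXi x (e i) X Y) (e i)
        + 2 * ∑ i, inner ℝ (S.nablaXi x X (e i) Y) (e i)
        - 2 * ∑ i, inner ℝ (S.xi x (S.xi x (e i) X) Y) (e i)
        + 2 * ∑ i, inner ℝ (S.xi x (S.xi x X (e i)) Y) (e i) :=
  lemma3p3_general (by omega) finrank_euclideanSpace_fin hD e X Y
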